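/- All arithmetic on ordinals is ordinal arithmetic, and ordinals carry the order topology. For ordinals $\beta$ and $\alpha_i$ ($i\in I$) and a positive integer $n$, write $\beta\to_{top}(\alpha_i)^n_{i\in I}$ (respectively $\beta\to_{cl}(\alpha_i)^n_{i\in I}$) if for every coloring $c:[\beta]^n\to I$ of the $n$-element subsets of $\beta$ there are $X\subseteq\beta$ and $i\in I$ such that $c$ is constantly $i$ on $[X]^n$ and $X$, with the subspace topology, is homeomorphic to $\alpha_i$ (respectively, some bijection $X\to\alpha_i$ is both an order isomorphism and a homeomorphism). Let $R^{top}(\alpha,k)$, $R^{cl}(\alpha,k)$ and $P^{cl}(\alpha_0,\alpha_1,\alpha_2)$ be the least ordinals $\beta$ with $\beta\to_{top}(\alpha,k)^2$, $\beta\to_{cl}(\alpha,k)^2$ and $\beta\to_{cl}(\alpha_0,\alpha_1,\alpha_2)^1$, respectively. Let $R(K^*_m,L_k)$ be the least positive integer $p$ such that every loopless digraph (edges in both directions between two vertices being allowed) on $p$ or more vertices has an independent set of size $m$ or contains, as a not necessarily induced subdigraph, a transitive tournament of order $k$. **Theorem.** Let $k$ and $m$ be positive integers. Then $R^{top}(\omega\cdot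 m+1,k+1)$ and $R^{cl}(\omega\cdot m+1,k+1)$ exist, and $$R^{top}(\omega\cdot m+1,k+1)=R^{cl}(\omega\cdot m+1,k+1)<\omega^\omega.$$ Moreover, $N=R(K^*_m,L_{k+1})$ and $R^{cl}(\omega\cdot m+1,k)$ exist, and so do all the pigeonhole numbers in the recursion $\beta_0=0$, $$\beta_{i+1}=P^{cl}\bigl(R^{cl}(\omega\cdot m+1,k),\,R^{cl}(\omega\cdot m+1,k),\,\omega^k+1+\beta_i\bigr)\qquad(i\ge 0),$$ and $$R^{cl}(\omega\cdot m+1,k+1)\le\omega^k+1+\beta_{N-1}<\omega^\omega.$$ In addition, $R^{cl}(\omega\cdot 2+1,3)\le\omega^8\cdot 7+1$. -/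

import Mathlib

open Ordinal

universe u v

namespace OrdinalRamsey

/-- `[β]^n`: the `n`-element sets of ordinals below `β`. -/
abbrev NSubsets (β : Ordinal.{u}) (n : ℕ) : Type (u + 1) :=
  {s : Finset Ordinal.{u} // (∀ x ∈ s, x < β) ∧ s.card = n}

/-- `[X]^n ⊆ c⁻¹({i})`. -/
def IsHomogeneous {β : Ordinal.{u}} {n : ℕ} {ι : Type v} (c : NSubsets β n → ι)
    (i : ι) (X : Set Ordinal.{u}) : Prop :=
  ∀ s : NSubsets β n, (s.1 : Set Ordinal.{u}) ⊆ X → c s = i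

/-- `X` is homeomorphic to the ordinal `α`. The class of ordinals carries the order topology, and
on the initial segments `Set.Iio β` the subspace topology is again the order topology. -/
def IsTopCopy (X : Set Ordinal.{u}) (α : Ordinal.{u}) : Prop :=
  Nonempty (X ≃ₜ Set.Iio α)

/-- `X` is order-homeomorphic to the ordinal `α`: one bijection is both an order isomorphism
and a homeomorphism. -/
def IsClosedCopy (X : Set Ordinal.{u}) (α : Ordinal.{u}) : Prop :=
  ∃ e : X ≃o Set.Iio α, Continuous e ∧ Continuous e.symm

/-- The topological partition relation `β →_top (α_i)^n_{i ∈ ι}`. -/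
def TopArrow (β : Ordinal.{u}) (n : ℕ) {ι : Type v} (α : ι → Ordinal.{u}) : Prop :=
  ∀ c : NSubsets β n → ι, ∃ (X : Set Ordinal.{u}) (i : ι),
    X ⊆ Set.Iio β ∧ IsHomogeneous c i X ∧ IsTopCopy X (α i)

/-- The closed partition relation `β →_cl (α_i)^n_{i ∈ ι}`. -/
def ClosedArrow (β : Ordinal.{u}) (n : ℕ) {ι : Type v} (α : ι → Ordinal.{u}) : Prop :=
  ∀ c : NSubsets β n → ι, ∃ (X : Set Ordinal.{u}) (i : ι),
    X ⊆ Set.Iio β ∧ IsHomogeneous c i X ∧ IsClosedCopy X (α i)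

/-- The topological Ramsey number `R^top(α, k)` (`0` if no such ordinal exists). -/
noncomputable def Rtop (α : Ordinal.{u}) (k : ℕ) : Ordinal.{u} :=
  sInf {β | TopArrow β 2 ![α, (k : Ordinal.{u})]}

/-- The closed Ramsey number `R^cl(α, k)` (`0` if no such ordinal exists). -/
noncomputable def Rcl (α : Ordinal.{u}) (k : ℕ) : Ordinal.{u} :=
  sInf {β | ClosedArrow β 2 ![α, (k : Ordinal.{u})]}

/-- The closed pigeonhole number `P^cl(α₀, α₁, α₂)` (`0` if no such ordinal exists). -/
noncomputable def Pcl (α₀ α₁ α₂ : Ordinal.{u}) : Ordinal.{u} :=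
  sInf {β | ClosedArrow β 1 ![α₀, α₁, α₂]}

/-- `D` has an independent set of size `m`: no edge in either direction between its members. -/
def HasIndependentSet {V : Type} (D : Digraph V) (m : ℕ) : Prop :=
  ∃ f : Fin m → V, Function.Injective f ∧ ∀ i j, ¬ D.Adj (f i) (f j)

/-- `D` has a transitive tournament of order `k` as a (not necessarily induced) subdigraph. -/
def HasTransitiveTournament {V : Type} (D : Digraph V) (k : ℕ) : Prop :=
  ∃ f : Fin k → V, Function.Injective f ∧ ∀ i j, i < j → D.Adj (f i) (f j)

/-- Every loopless digraph on `p` or more vertices has an independent set of size `m` or a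
transitive tournament of order `k`. -/
def DigraphArrow (p m k : ℕ) : Prop :=
  ∀ n, p ≤ n → ∀ D : Digraph (Fin n), (∀ v, ¬ D.Adj v v) →
    HasIndependentSet D m ∨ HasTransitiveTournament D k

/-- The digraph Ramsey number `R(K*_m, L_k)`, the least positive `p` with `DigraphArrow p m k`
(`0` if none exists). -/
noncomputable def digraphRamsey (m k : ℕ) : ℕ :=
  sInf {p | 0 < p ∧ DigraphArrow p m k}

/-- The sequence `β₀ = 0`,
`β_{i+1} = P^cl(R^cl(ω·m+1, k), R^cl(ω·m+1, k), ω^k + 1 + β_i)`. -/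
noncomputable def stepSeq (m k : ℕ) : ℕ → Ordinal.{u}
  | 0 => 0
  | i + 1 => Pcl (Rcl (ω * m + 1) k) (Rcl (ω * m + 1) k) (ω ^ k + 1 + stepSeq m k i)

end OrdinalRamsey

namespace OrdinalRamsey

/-! Call a pair blue if `B` holds on it (colour 1) and red otherwise. A closed copy of `α` is the
image of a strictly increasing map on `α` that is continuous at limits (`NormalOn`); such maps
compose, and they concatenate when their lengths are successors.

For `m = 1`, `ω ^ k + 1` suffices (`LimRank.exists_isRedSeq`). For general `m`, take a red copy of
`ω + 1` in the first `ω ^ k + 1` points, with points `y n` and top `z`, fix a nonprincipal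
ultrafilter on `ℕ`, and sort the later points `v`: those blue to `z`, those blue to almost all `y
n`, and the rest. Inside the first two classes a closed copy of `R^cl(ω·m+1, k)` yields a red copy
of `ω·m+1`, or a blue `k`-set which `z` or some `y n` extends. Otherwise the third class contains
room for another round. Iterating (`exists_isRedChain`) produces `N` red copies of `ω + 1` such that
later points are red to the top and to almost all points of each earlier copy.

The only undecided pairs join the `n`-th point of an earlier copy to the `l`-th point of a later one
with `n` before `l`. The ultrafilter decides them, which defines a digraph on the `N` copies: after
thinning out, an independent set of size `m` gives a red `ω·m+1`, and a transitive tournament of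
order `k+1` a blue `(k+1)`-set (`IsRedChain.hasHomogeneous`).

All numbers stay below `ω ^ ω` by a closed pigeonhole principle (`closedArrow_one_mul`): a point of
limit rank `r` distributes its rank `r` among the colours. The topological and closed numbers agree
because a homeomorphic copy of `ω·m+1` contains a closed copy (`IsTopCopy.exists_normalOn`). -/

open Set Filter Topology Order

/-! ### Continuous increasing maps and closed copies -/

/-- `f` is strictly increasing and continuous at limits on the initial segment below `α`. -/
structure NormalOn (f : Ordinal.{u} → Ordinal.{u}) (α : Ordinal.{u}) : Prop where
  lt : ∀ ⦃x y⦄, x < y → y < α → f x < f y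
  lim : ∀ ⦃l⦄, l < α → IsSuccLimit l → ∀ b < f l, ∃ a < l, b < f a

/-- `y` is a strictly increasing sequence with supremum `x`. -/
structure IsSeqLim (y : ℕ → Ordinal.{u}) (x : Ordinal.{u}) : Prop where
  mono : StrictMono y
  lt : ∀ n, y n < x
  lub : ∀ b < x, ∃ n, b < y n

theorem NormalOn.mono {f : Ordinal.{u} → Ordinal.{u}} {α β : Ordinal.{u}} (h : NormalOn f β)
    (hab : α ≤ β) : NormalOn f α :=
  ⟨fun _ _ hxy hy => h.lt hxy (hy.trans_le hab), fun _ hl => h.lim (hl.trans_le hab)⟩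

theorem NormalOn.le {f : Ordinal.{u} → Ordinal.{u}} {α x y : Ordinal.{u}} (h : NormalOn f α)
    (hxy : x ≤ y) (hy : y < α) : f x ≤ f y := by
  rcases hxy.eq_or_lt with rfl | hxy
  · exact le_rfl
  · exact (h.lt hxy hy).le

theorem NormalOn.lt_iff {f : Ordinal.{u} → Ordinal.{u}} {α x y : Ordinal.{u}} (h : NormalOn f α)
    (hx : x < α) (hy : y < α) : f x < f y ↔ x < y := by
  refine ⟨fun hf => ?_, fun hxy => h.lt hxy hy⟩
  by_contra! hc
  exact (h.le hc hx).not_gt hf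

theorem NormalOn.comp {f g : Ordinal.{u} → Ordinal.{u}} {α β : Ordinal.{u}} (hg : NormalOn g β)
    (hf : NormalOn f α) (hfb : ∀ x < α, f x < β) : NormalOn (fun x => g (f x)) α := by
  refine ⟨fun x y hxy hy => hg.lt (hf.lt hxy hy) (hfb y hy), fun l hl hlim b hb => ?_⟩
  -- Continuity of `g` at `f l` can be used only because `f l` is again a limit.
  have hfl : IsSuccLimit (f l) := by
    refine ⟨?_, ?_⟩
    · intro hmin
      have h0 : f 0 < f l :=
        hf.lt (pos_iff_ne_zero.2 (by rintro rfl; exact not_isSuccLimit_zero hlim)) hl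
      exact hmin.not_lt h0
    · intro c hc
      obtain ⟨a, ha, hca⟩ := hf.lim hl hlim c hc.lt
      exact hc.2 hca (hf.lt ha hl)
  obtain ⟨c, hc, hbc⟩ := hg.lim (hfb l hl) hfl b hb
  obtain ⟨a, ha, hca⟩ := hf.lim hl hlim c hc
  exact ⟨a, ha, hbc.trans (hg.lt hca (hfb a (ha.trans hl)))⟩

theorem normalOn_add (γ α : Ordinal.{u}) : NormalOn (fun x => γ + x) α := by
  refine ⟨fun x y hxy _ => by simpa using hxy, fun l _ hl b hb => ?_⟩
  exact (lt_add_iff_of_isSuccLimit hl).1 hb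

theorem normalOn_id (α : Ordinal.{u}) : NormalOn (fun x => x) α := by
  simpa using normalOn_add 0 α

theorem IsSeqLim.isSuccLimit {y : ℕ → Ordinal.{u}} {x : Ordinal.{u}} (h : IsSeqLim y x) :
    IsSuccLimit x := by
  refine ⟨fun hmin => hmin.not_lt (h.lt 0), fun c hc => ?_⟩
  obtain ⟨n, hn⟩ := h.lub c hc.lt
  exact hc.2 hn (h.lt n)

theorem IsSeqLim.comp {y : ℕ → Ordinal.{u}} {x : Ordinal.{u}} (h : IsSeqLim y x) {φ : ℕ → ℕ}
    (hφ : StrictMono φ) : IsSeqLim (fun n => y (φ n)) x :=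
  ⟨h.mono.comp hφ, fun n => h.lt _, fun b hb => by
    obtain ⟨n, hn⟩ := h.lub b hb
    exact ⟨n, hn.trans_le (h.mono.monotone (hφ.id_le n))⟩⟩

theorem IsSeqLim.map {y : ℕ → Ordinal.{u}} {x α : Ordinal.{u}} (h : IsSeqLim y x)
    {f : Ordinal.{u} → Ordinal.{u}} (hf : NormalOn f α) (hx : x < α) :
    IsSeqLim (fun n => f (y n)) (f x) := by
  refine ⟨fun m n hmn => hf.lt (h.mono hmn) ((h.lt n).trans hx), fun n => hf.lt (h.lt n) hx,
    fun b hb => ?_⟩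
  obtain ⟨a, ha, hba⟩ := hf.lim hx h.isSuccLimit b hb
  obtain ⟨n, hn⟩ := h.lub a ha
  exact ⟨n, hba.trans (hf.lt hn ((h.lt n).trans hx))⟩

/-- The given sequence serves only to witness countable cofinality: each chosen point is taken
beyond the next `y n`. -/
theorem IsSeqLim.exists_of_cofinal {y : ℕ → Ordinal.{u}} {x : Ordinal.{u}} (h : IsSeqLim y x)
    {P : Ordinal.{u} → Prop} (hP : ∀ b < x, ∃ z, b < z ∧ z < x ∧ P z) :
    ∃ z, IsSeqLim z x ∧ ∀ n, P (z n) := by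
  choose! g hg hgx hgP using hP
  let z : ℕ → Ordinal.{u} := fun n => Nat.rec (g (y 0)) (fun n c => g (max (y (n + 1)) c)) n
  have hz : ∀ n, z (n + 1) = g (max (y (n + 1)) (z n)) := fun n => rfl
  have hzx : ∀ n, z n < x := by
    intro n
    induction n with
    | zero => exact hgx _ (h.lt 0)
    | succ n ih => rw [hz]; exact hgx _ (max_lt (h.lt _) ih)
  have hyz : ∀ n, y n < z n := by
    intro n
    cases n with
    | zero => exact hg _ (h.lt 0)
    | succ n => rw [hz]; exact (le_max_left _ _).trans_lt (hg _ (max_lt (h.lt _) (hzx n)))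
  refine ⟨z, ⟨strictMono_nat_of_lt_succ fun n => ?_, hzx, fun b hb => ?_⟩, fun n => ?_⟩
  · rw [hz]; exact (le_max_right _ _).trans_lt (hg _ (max_lt (h.lt _) (hzx n)))
  · obtain ⟨n, hn⟩ := h.lub b hb
    exact ⟨n, hn.trans (hyz n)⟩
  · cases n with
    | zero => exact hgP _ (h.lt 0)
    | succ n => rw [hz]; exact hgP _ (max_lt (h.lt _) (hzx n))

theorem IsSeqLim.exists_gt {y : ℕ → Ordinal.{u}} {x b : Ordinal.{u}} (h : IsSeqLim y x)
    (hb : b < x) : ∃ m, IsSeqLim (fun n => y (m + n)) x ∧ ∀ n, b < y (m + n) := by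
  obtain ⟨m, hm⟩ := h.lub b hb
  exact ⟨m, h.comp (φ := fun n => m + n) (fun a b hab => by simpa using hab),
    fun n => hm.trans_le (h.mono.monotone (Nat.le_add_right _ _))⟩

/-- The image of a continuous increasing map is a closed copy. -/
theorem NormalOn.isClosedCopy {f : Ordinal.{u} → Ordinal.{u}} {α : Ordinal.{u}}
    (h : NormalOn f α) : IsClosedCopy (f '' Iio α) α := by
  have hmono : StrictMonoOn f (Iio α) := fun x _ y hy hxy => h.lt hxy hy
  let e := hmono.orderIso f (Iio α)
  refine ⟨e.symm, ?_, ?_⟩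
  · refine continuous_iff_continuousAt.2 fun x => tendsto_order.2 ⟨fun a ha => ?_, fun a ha => ?_⟩
    · have : (e a : Ordinal) < x := by
        have := e.strictMono ha
        rw [e.apply_symm_apply] at this
        exact this
      filter_upwards [continuous_subtype_val.continuousAt.eventually (lt_mem_nhds this)] with y hy
      rw [e.lt_symm_apply]
      exact hy
    · have : (x : Ordinal) < e a := by
        have := e.strictMono ha
        rw [e.apply_symm_apply] at this
        exact this
      filter_upwards [continuous_subtype_val.continuousAt.eventually (gt_mem_nhds this)] with y hy
      rw [e.symm_apply_lt]
      exact hy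
  · have hc : Continuous fun x : Iio α => f x := by
      refine continuous_iff_continuousAt.2 fun x => tendsto_order.2 ⟨fun b hb => ?_, fun b hb => ?_⟩
      · obtain h0 | ⟨z, hz⟩ | hl := zero_or_succ_or_isSuccLimit (x : Ordinal)
        · filter_upwards with y
          exact hb.trans_le (h.le (by rw [h0]; exact zero_le) y.2)
        · have hzx : z < (x : Ordinal) := by rw [← hz]; exact lt_succ z
          filter_upwards [continuous_subtype_val.continuousAt.eventually (lt_mem_nhds hzx)] with y hy
          exact hb.trans_le (h.le (by rw [← hz]; exact succ_le_of_lt hy) y.2)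
        · obtain ⟨a, ha, hba⟩ := h.lim x.2 hl b hb
          filter_upwards [continuous_subtype_val.continuousAt.eventually (lt_mem_nhds ha)] with y hy
          exact hba.trans (h.lt hy y.2)
      -- From above nothing needs proof beyond monotonicity: points below `succ x` are at most `x`.
      · filter_upwards [continuous_subtype_val.continuousAt.eventually
          (gt_mem_nhds (lt_succ (x : Ordinal)))] with y hy
        exact (h.le (lt_succ_iff.1 hy) x.2).trans_lt hb
    exact Continuous.subtype_mk hc _

theorem IsClosedCopy.exists_normalOn {X : Set Ordinal.{u}} {α : Ordinal.{u}}
    (h : IsClosedCopy X α) : ∃ f, NormalOn f α ∧ ∀ x < α, f x ∈ X := by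
  obtain ⟨e, -, he⟩ := h
  classical
  let f : Ordinal.{u} → Ordinal.{u} := fun x => if h : x < α then e.symm ⟨x, h⟩ else 0
  have hf : ∀ x (hx : x < α), f x = e.symm ⟨x, hx⟩ := fun x hx => dif_pos hx
  refine ⟨f, ⟨fun x y hxy hy => ?_, fun l hl hlim b hb => ?_⟩, fun x hx => ?_⟩
  · rw [hf x (hxy.trans hy), hf y hy]
    exact e.symm.strictMono hxy
  · rw [hf l hl] at hb
    have h1 := (continuous_subtype_val.comp he).continuousAt.eventually
      (lt_mem_nhds (a := b) (b := ((e.symm ⟨l, hl⟩ : X) : Ordinal)) hb)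
    rw [nhds_subtype, eventually_comap] at h1
    obtain ⟨c, hc, hcl⟩ := (mem_nhds_iff_exists_Ioo_subset' (a := l)
      ⟨0, pos_iff_ne_zero.2 (by rintro rfl; exact not_isSuccLimit_zero hlim)⟩
      ⟨_, lt_succ l⟩).1 h1
    -- The interval is open at `c`, so its first usable point is `succ c`, still below the limit
    -- `l`.
    refine ⟨succ c, hlim.succ_lt hcl.1.1, ?_⟩
    have h2 := hlim.succ_lt hcl.1.1
    rw [hf _ (h2.trans hl)]
    exact hcl.2 ⟨lt_succ c, h2.trans hcl.1.2⟩ ⟨succ c, h2.trans hl⟩ rfl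
  · rw [hf x hx]; exact (e.symm _).2

theorem IsClosedCopy.isTopCopy {X : Set Ordinal.{u}} {α : Ordinal.{u}}
    (h : IsClosedCopy X α) : IsTopCopy X α := by
  obtain ⟨e, h1, h2⟩ := h
  exact ⟨⟨e.toEquiv, h1, h2⟩⟩
-- Partition relations in terms of increasing maps
/-- The partition relation `β → (α, k)²` in terms of a relation `B` (read for `x < y`). -/
def PairArrow (β α : Ordinal.{u}) (k : ℕ) : Prop :=
  ∀ B : Ordinal.{u} → Ordinal.{u} → Prop,
    (∃ f, NormalOn f α ∧ (∀ x < α, f x < β) ∧ ∀ x y, x < y → y < α → ¬ B (f x) (f y)) ∨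
    ∃ s : Finset Ordinal.{u}, s.card = k ∧ (∀ x ∈ s, x < β) ∧ ∀ x ∈ s, ∀ y ∈ s, x < y → B x y

theorem exists_finset_of_equiv {X : Set Ordinal.{u}} {k : ℕ}
    (e : X ≃ Iio (k : Ordinal.{u})) :
    ∃ s : Finset Ordinal.{u}, s.card = k ∧ (s : Set Ordinal.{u}) ⊆ X := by
  let f : Fin k → Ordinal.{u} := fun n => e.symm ⟨(n : ℕ), by simp⟩
  have hf : Function.Injective f := by
    intro a b hab
    have h1 := e.symm.injective (Subtype.ext hab)
    have h2 : ((a : ℕ) : Ordinal.{u}) = (b : ℕ) := congrArg Subtype.val h1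
    exact Fin.ext (by exact_mod_cast h2)
  refine ⟨Finset.univ.image f, by simp [Finset.card_image_of_injective _ hf], ?_⟩
  intro x hx
  simp only [Finset.coe_image, Finset.coe_univ, image_univ, mem_range] at hx
  obtain ⟨n, rfl⟩ := hx
  exact (e.symm _).2

theorem exists_normalOn_of_finset {s : Finset Ordinal.{u}} {k : ℕ} (hs : s.card = k) :
    ∃ f, NormalOn f (k : Ordinal.{u}) ∧ ∀ x < (k : Ordinal.{u}), f x ∈ s := by
  let g : ℕ → Ordinal.{u} := fun n => if h : n < k then s.orderEmbOfFin hs ⟨n, h⟩ else 0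
  have hg : ∀ n (h : n < k), g n = s.orderEmbOfFin hs ⟨n, h⟩ := fun n h => dif_pos h
  let f : Ordinal.{u} → Ordinal.{u} := Function.extend (Nat.cast : ℕ → Ordinal.{u}) g 0
  have hf : ∀ n : ℕ, f n = g n := fun n =>
    Function.Injective.extend_apply Nat.cast_injective g 0 n
  have hnat : ∀ x < (k : Ordinal.{u}), ∃ n : ℕ, x = n ∧ n < k := by
    intro x hx
    obtain ⟨n, rfl⟩ := lt_omega0.1 (hx.trans (natCast_lt_omega0 k))
    exact ⟨n, rfl, by exact_mod_cast hx⟩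
  refine ⟨f, ⟨fun x y hxy hy => ?_, fun l hl hlim => ?_⟩, fun x hx => ?_⟩
  · obtain ⟨m, rfl, hm⟩ := hnat x (hxy.trans hy)
    obtain ⟨n, rfl, hn⟩ := hnat y hy
    rw [hf, hf, hg m hm, hg n hn]
    exact (s.orderEmbOfFin hs).strictMono (by simpa using hxy)
  · exact absurd (hl.trans (natCast_lt_omega0 k)) (omega0_le_of_isSuccLimit hlim).not_gt
  · obtain ⟨m, rfl, hm⟩ := hnat x hx
    rw [hf, hg m hm]
    exact s.orderEmbOfFin_mem hs _

theorem isHomogeneous_pair {β : Ordinal.{u}} {c : NSubsets β 2 → Fin 2} {i : Fin 2}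
    {X : Set Ordinal.{u}} (h : ∀ x y (hxy : x < y) (hy : y < β), x ∈ X → y ∈ X →
      c ⟨{x, y}, by simp [hy, hxy.trans hy], Finset.card_pair hxy.ne⟩ = i) :
    IsHomogeneous c i X := by
  rintro ⟨s, hs, hcard⟩ hsX
  obtain ⟨x, y, hxy, rfl⟩ := Finset.card_eq_two.1 hcard
  rcases hxy.lt_or_gt with hlt | hlt
  · exact h x y hlt (hs y (by simp)) (hsX (by simp)) (hsX (by simp))
  · have := h y x hlt (hs x (by simp)) (hsX (by simp)) (hsX (by simp))
    rw [← this]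
    congr 2
    exact Finset.pair_comm x y

theorem closedArrow_of_pairArrow {β α : Ordinal.{u}} {k : ℕ} (h : PairArrow β α k) :
    ClosedArrow β 2 ![α, (k : Ordinal.{u})] := by
  intro c
  rcases h (fun x y => ∃ (hxy : x < y) (hy : y < β),
      c ⟨{x, y}, by simp [hy, hxy.trans hy], Finset.card_pair hxy.ne⟩ = 1) with
    ⟨f, hf, hfb, hB⟩ | ⟨s, hs, hsb, hB⟩
  · refine ⟨f '' Iio α, 0, ?_, isHomogeneous_pair ?_, hf.isClosedCopy⟩
    · rintro _ ⟨x, hx, rfl⟩; exact hfb x hx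
    · rintro _ _ hxy hy ⟨x, hx, rfl⟩ ⟨y, hy', rfl⟩
      have := hB x y ((hf.lt_iff hx hy').1 hxy) hy'
      by_contra hc
      exact this ⟨hxy, hy, Fin.eq_one_of_ne_zero _ hc⟩
  · obtain ⟨f, hf, hfs⟩ := exists_normalOn_of_finset hs
    refine ⟨f '' Iio (k : Ordinal), 1, ?_, isHomogeneous_pair ?_, hf.isClosedCopy⟩
    · rintro _ ⟨x, hx, rfl⟩; exact hsb _ (hfs x hx)
    · rintro _ _ hxy hy ⟨x, hx, rfl⟩ ⟨y, hy', rfl⟩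
      obtain ⟨_, _, h⟩ := hB _ (hfs x hx) _ (hfs y hy') hxy
      exact h

theorem pairArrow_of_coloring {β α : Ordinal.{u}} {k : ℕ}
    (h : ∀ c : NSubsets β 2 → Fin 2,
      (∃ f, NormalOn f α ∧ (∀ x < α, f x < β) ∧ IsHomogeneous c 0 (f '' Iio α)) ∨
      ∃ X ⊆ Iio β, IsHomogeneous c 1 X ∧ Nonempty (X ≃ Iio (k : Ordinal.{u}))) :
    PairArrow β α k := by
  classical
  intro B
  rcases h (fun s => if ∀ x ∈ s.1, ∀ y ∈ s.1, x < y → B x y then 1 else 0) with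
    ⟨f, hf, hfb, hB⟩ | ⟨X, hX, hB, ⟨e⟩⟩
  · refine Or.inl ⟨f, hf, hfb, fun x y hxy hy hxyB => ?_⟩
    have hlt := hf.lt hxy hy
    have := hB ⟨{f x, f y}, by simp [hfb _ hy, hfb _ (hxy.trans hy)], Finset.card_pair hlt.ne⟩
      (by
        simp only [Finset.coe_insert, Finset.coe_singleton]
        rintro _ (rfl | rfl)
        exacts [⟨x, hxy.trans hy, rfl⟩, ⟨y, hy, rfl⟩])
    simp [hlt.not_gt, hxyB] at this
  · obtain ⟨s, hs, hsX⟩ := exists_finset_of_equiv e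
    refine Or.inr ⟨s, hs, fun x hx => hX (hsX hx), fun x hx y hy hxy => ?_⟩
    have := hB ⟨{x, y}, by simpa using ⟨hX (hsX hx), hX (hsX hy)⟩, Finset.card_pair hxy.ne⟩
      (by
        simp only [Finset.coe_insert, Finset.coe_singleton]
        rintro _ (rfl | rfl)
        exacts [hsX hx, hsX hy])
    simp only [ite_eq_left_iff] at this
    by_contra hc
    exact absurd (this (fun h => hc (h x (by simp) y (by simp) hxy))) (by decide)

theorem pairArrow_of_closedArrow {β α : Ordinal.{u}} {k : ℕ}
    (h : ClosedArrow β 2 ![α, (k : Ordinal.{u})]) : PairArrow β α k := by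
  refine pairArrow_of_coloring fun c => ?_
  obtain ⟨X, i, hX, hc, he⟩ := h c
  fin_cases i
  · obtain ⟨f, hf, hfX⟩ := he.exists_normalOn
    refine Or.inl ⟨f, hf, fun x hx => hX (hfX x hx), fun s hs => hc s (hs.trans ?_)⟩
    rintro _ ⟨x, hx, rfl⟩
    exact hfX x hx
  · obtain ⟨e, -⟩ := he
    exact Or.inr ⟨X, hX, hc, ⟨e.toEquiv⟩⟩

theorem ClosedArrow.topArrow {β : Ordinal.{u}} {n : ℕ} {ι : Type v} {α : ι → Ordinal.{u}}
    (h : ClosedArrow β n α) : TopArrow β n α := by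
  intro c
  obtain ⟨X, i, hX, hc, he⟩ := h c
  exact ⟨X, i, hX, hc, he.isTopCopy⟩

theorem closedArrow_one_iff {β : Ordinal.{u}} {ι : Type v} [Inhabited ι] {α : ι → Ordinal.{u}} :
    ClosedArrow β 1 α ↔ ∀ c : Ordinal.{u} → ι, ∃ i f, NormalOn f (α i) ∧
      ∀ x < α i, f x < β ∧ c (f x) = i := by
  classical
  constructor
  · intro h c
    obtain ⟨X, i, hX, hc, he⟩ := h (fun s => c (Finset.card_eq_one.1 s.2.2).choose)
    obtain ⟨f, hf, hfX⟩ := he.exists_normalOn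
    refine ⟨i, f, hf, fun x hx => ⟨hX (hfX x hx), ?_⟩⟩
    have h1 := hc ⟨{f x}, by simpa using hX (hfX x hx), by simp⟩ (by simpa using hfX x hx)
    have h2 : ∀ (p : ∃ a, ({f x} : Finset Ordinal) = {a}), p.choose = f x := fun p => by
      have := p.choose_spec
      simpa using this.symm
    simpa [h2] using h1
  · intro h c
    obtain ⟨i, f, hf, hfc⟩ := h (fun x => if hx : x < β then c ⟨{x}, by simpa using hx, by simp⟩
      else default)
    refine ⟨f '' Iio (α i), i, ?_, ?_, hf.isClosedCopy⟩
    · rintro _ ⟨x, hx, rfl⟩; exact (hfc x hx).1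
    · rintro ⟨s, hs, hcard⟩ hsX
      obtain ⟨a, rfl⟩ := Finset.card_eq_one.1 hcard
      obtain ⟨x, hx, rfl⟩ := hsX (show a ∈ _ by simp)
      obtain ⟨h1, h2⟩ := hfc x hx
      rw [dif_pos h1] at h2
      exact h2

/-- The partition relation transported along a continuous increasing map. -/
theorem PairArrow.map {β α : Ordinal.{u}} {k : ℕ} (h : PairArrow β α k)
    {g : Ordinal.{u} → Ordinal.{u}} (hg : NormalOn g β) (B : Ordinal.{u} → Ordinal.{u} → Prop) :
    (∃ f, NormalOn f α ∧ (∀ x < α, ∃ z < β, f x = g z) ∧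
      ∀ x y, x < y → y < α → ¬ B (f x) (f y)) ∨
    ∃ s : Finset Ordinal.{u}, s.card = k ∧ (∀ x ∈ s, ∃ z < β, x = g z) ∧
      ∀ x ∈ s, ∀ y ∈ s, x < y → B x y := by
  classical
  rcases h (fun x y => B (g x) (g y)) with ⟨f, hf, hfb, hB⟩ | ⟨s, hs, hsb, hB⟩
  · exact Or.inl ⟨_, hg.comp hf hfb, fun x hx => ⟨_, hfb x hx, rfl⟩, hB⟩
  · have hinj : InjOn g s := fun x hx y hy hxy => by
      rcases lt_trichotomy x y with h | h | h
      · exact absurd hxy (hg.lt h (hsb y hy)).ne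
      · exact h
      · exact absurd hxy (hg.lt h (hsb x hx)).ne'
    refine Or.inr ⟨s.image g, by rw [Finset.card_image_of_injOn hinj, hs], ?_, ?_⟩
    · intro x hx
      obtain ⟨z, hz, rfl⟩ := Finset.mem_image.1 hx
      exact ⟨z, hsb z hz, rfl⟩
    · intro x hx y hy hxy
      obtain ⟨z, hz, rfl⟩ := Finset.mem_image.1 hx
      obtain ⟨w, hw, rfl⟩ := Finset.mem_image.1 hy
      exact hB z hz w hw ((hg.lt_iff (hsb z hz) (hsb w hw)).1 hxy)
-- Concatenating copies
/-- The concatenation of maps `F 0, F 1, …`, each on a block of length `δ + 1`. -/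
noncomputable def blockMap (δ : Ordinal.{u}) (F : ℕ → Ordinal.{u} → Ordinal.{u})
    (x : Ordinal.{u}) : Ordinal.{u} :=
  Function.extend (Nat.cast : ℕ → Ordinal.{u}) F 0 (x / (δ + 1)) (x % (δ + 1))

theorem add_one_ne_zero' (δ : Ordinal.{u}) : δ + 1 ≠ 0 := (add_pos_of_nonneg_of_pos zero_le one_pos).ne'

theorem blockMap_apply (δ : Ordinal.{u}) (F : ℕ → Ordinal.{u} → Ordinal.{u}) (n : ℕ)
    {r : Ordinal.{u}} (hr : r < δ + 1) : blockMap δ F ((δ + 1) * n + r) = F n r := by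
  unfold blockMap
  rw [mul_add_div _ (add_one_ne_zero' δ), div_eq_zero_of_lt hr, add_zero, mul_add_mod_self,
    mod_eq_of_lt hr, Function.Injective.extend_apply Nat.cast_injective]

theorem exists_block {δ η x : Ordinal.{u}} (hη : η ≤ ω) (hx : x < (δ + 1) * η) :
    ∃ n : ℕ, (n : Ordinal.{u}) < η ∧ ∃ r < δ + 1, x = (δ + 1) * n + r := by
  have h1 : x / (δ + 1) < η := (lt_mul_iff_div_lt (add_one_ne_zero' δ)).1 hx
  obtain ⟨n, hn⟩ := lt_omega0.1 (h1.trans_le hη)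
  refine ⟨n, hn ▸ h1, x % (δ + 1), mod_lt _ (add_one_ne_zero' δ), ?_⟩
  rw [← hn, div_add_mod]

/-- Blocks have successor length, so no limit ordinal sits at the start of a block. Hence the gaps
between consecutive images are harmless and only their order matters. -/
theorem NormalOn.blocks {δ η : Ordinal.{u}} {F : ℕ → Ordinal.{u} → Ordinal.{u}} (hη : η ≤ ω)
    (hF : ∀ n : ℕ, (n : Ordinal.{u}) < η → NormalOn (F n) (δ + 1))
    (hlt : ∀ n : ℕ, ((n + 1 : ℕ) : Ordinal.{u}) < η → F n δ < F (n + 1) 0) :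
    NormalOn (blockMap δ F) ((δ + 1) * η) := by
  have hδ : δ < δ + 1 := lt_succ δ
  have h0 : (0 : Ordinal) < δ + 1 := zero_le.trans_lt hδ
  have key : ∀ m n : ℕ, m < n → (n : Ordinal.{u}) < η → F m δ < F n 0 := by
    intro m n hmn
    induction n, hmn using Nat.le_induction with
    | base => exact fun h => hlt m h
    | succ n hmn ih =>
      intro h
      have hn : (n : Ordinal.{u}) < η := lt_of_le_of_lt (by exact_mod_cast Nat.le_succ n) h
      exact (ih hn).trans (((hF n hn).le zero_le hδ).trans_lt (hlt n h))
  refine ⟨fun x y hxy hy => ?_, fun l hl hlim b hb => ?_⟩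
  · obtain ⟨n, hn, r, hr, rfl⟩ := exists_block hη hy
    obtain ⟨m, hm, s, hs, rfl⟩ := exists_block hη (hxy.trans hy)
    rw [blockMap_apply δ F m hs, blockMap_apply δ F n hr]
    have hmn : m ≤ n := by
      have := div_le_left hxy.le (δ + 1)
      rw [mul_add_div _ (add_one_ne_zero' δ), div_eq_zero_of_lt hs, add_zero,
        mul_add_div _ (add_one_ne_zero' δ), div_eq_zero_of_lt hr, add_zero] at this
      exact_mod_cast this
    rcases hmn.eq_or_lt with rfl | hmn
    · exact (hF m hm).lt (by simpa using hxy) hr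
    · exact ((hF m hm).le (lt_succ_iff.1 hs) hδ).trans_lt
        ((key m n hmn hn).trans_le ((hF n hn).le zero_le hr))
  · obtain ⟨n, hn, r, hr, rfl⟩ := exists_block hη hl
    have hrl : IsSuccLimit r := by
      rcases (isSuccLimit_add_iff.1 hlim) with h | ⟨rfl, h⟩
      · exact h
      · exfalso
        cases n with
        | zero => simp at h
        | succ n =>
          have : (δ + 1) * ((n + 1 : ℕ) : Ordinal) = succ ((δ + 1) * (n : Ordinal) + δ) := by
            rw [Nat.cast_add, Nat.cast_one, mul_add, mul_one, ← add_assoc]; rfl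
          rw [this] at h
          exact not_isSuccLimit_succ _ h
    rw [blockMap_apply δ F n hr] at hb
    obtain ⟨a, ha, hba⟩ := (hF n hn).lim hr hrl b hb
    exact ⟨(δ + 1) * n + a, by simpa using ha, by rwa [blockMap_apply δ F n (ha.trans hr)]⟩

theorem NormalOn.snoc {f : Ordinal.{u} → Ordinal.{u}} {α p : Ordinal.{u}} (hf : NormalOn f α)
    (hlt : ∀ x < α, f x < p) (hlub : ∀ b < p, ∃ x < α, b < f x) :
    NormalOn (Function.update f α p) (α + 1) := by
  have h1 : ∀ x < α, Function.update f α p x = f x := fun x hx => Function.update_of_ne hx.ne _ _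
  refine ⟨fun x y hxy hy => ?_, fun l hl hlim b hb => ?_⟩
  · rcases (lt_succ_iff.1 hy).eq_or_lt with rfl | hy
    · rw [h1 x hxy, Function.update_self]; exact hlt x hxy
    · rw [h1 x (hxy.trans hy), h1 y hy]; exact hf.lt hxy hy
  · rcases (lt_succ_iff.1 hl).eq_or_lt with rfl | hl
    · rw [Function.update_self] at hb
      obtain ⟨x, hx, hbx⟩ := hlub b hb
      exact ⟨x, hx, by rwa [h1 x hx]⟩
    · rw [h1 l hl] at hb
      obtain ⟨a, ha, hba⟩ := hf.lim hl hlim b hb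
      exact ⟨a, ha, by rwa [h1 a (ha.trans hl)]⟩

/-- Consecutive copies of `δ + 1` together with their supremum. -/
theorem exists_normalOn_omega {δ x : Ordinal.{u}} {F : ℕ → Ordinal.{u} → Ordinal.{u}}
    (hF : ∀ n, NormalOn (F n) (δ + 1)) (hlt : ∀ n, F n δ < F (n + 1) 0)
    (hx : ∀ n, F n δ < x) (hlub : ∀ b < x, ∃ n, b < F n 0) :
    ∃ f, NormalOn f ((δ + 1) * ω + 1) ∧
      ∀ y < (δ + 1) * ω + 1, f y = x ∨ ∃ n, ∃ r < δ + 1, f y = F n r := by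
  have hδ : δ < δ + 1 := lt_succ δ
  have h0 : (0 : Ordinal) < δ + 1 := zero_le.trans_lt hδ
  refine ⟨_, (NormalOn.blocks le_rfl (fun n _ => hF n) fun n _ => hlt n).snoc (p := x) ?_ ?_, ?_⟩
  · intro y hy
    obtain ⟨n, -, r, hr, rfl⟩ := exists_block le_rfl hy
    rw [blockMap_apply δ F n hr]
    exact ((hF n).le (lt_succ_iff.1 hr) hδ).trans_lt (hx n)
  · intro b hb
    obtain ⟨n, hn⟩ := hlub b hb
    refine ⟨(δ + 1) * n + 0, ?_, by rwa [blockMap_apply δ F n h0]⟩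
    rw [add_zero]
    exact mul_lt_mul_of_pos_left (natCast_lt_omega0 n) h0
  · intro y hy
    rcases (lt_succ_iff.1 hy).eq_or_lt with rfl | hy
    · exact Or.inl (Function.update_self ..)
    · right
      rw [Function.update_of_ne hy.ne]
      obtain ⟨n, -, r, hr, rfl⟩ := exists_block le_rfl hy
      exact ⟨n, r, hr, blockMap_apply δ F n hr⟩

/-- A closed copy of `ω + 1`. -/
theorem IsSeqLim.exists_normalOn {y : ℕ → Ordinal.{u}} {x : Ordinal.{u}} (h : IsSeqLim y x) :
    ∃ f : Ordinal.{u} → Ordinal.{u}, NormalOn f (ω + 1) ∧ (∀ n : ℕ, f n = y n) ∧ f ω = x := by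
  -- Blocks of length one: block `n` is the point `n` of `ω`.
  have h1 : ∀ n, NormalOn (fun _ : Ordinal.{u} => y n) (0 + 1) := fun n =>
    ⟨fun a b hab hb => by
      rw [zero_add, Order.lt_one_iff] at hb
      exact absurd hab (by simp [hb]),
      fun l hl hlim => by
      rw [zero_add, Order.lt_one_iff] at hl
      exact absurd hlim (by simp [hl])⟩
  have h2 := (NormalOn.blocks (δ := 0) (F := fun n _ => y n) le_rfl (fun n _ => h1 n)
    (fun n _ => h.mono (Nat.lt_succ_self n)))
  have hb : ∀ n : ℕ, blockMap 0 (fun n _ => y n) (n : Ordinal) = y n := fun n => by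
    simpa using blockMap_apply 0 (fun n (_ : Ordinal) => y n) n (r := 0) (by simp)
  rw [zero_add, one_mul] at h2
  refine ⟨_, h2.snoc (p := x) ?_ ?_, fun n => ?_, Function.update_self ..⟩
  · intro z hz
    obtain ⟨n, rfl⟩ := lt_omega0.1 hz
    rw [hb]; exact h.lt n
  · intro b hbx
    obtain ⟨n, hn⟩ := h.lub b hbx
    exact ⟨n, natCast_lt_omega0 n, by rwa [hb]⟩
  · rw [Function.update_of_ne (natCast_lt_omega0 n).ne, hb]

/-! ### Limit ranks and the pigeonhole principle -/

/-- The order types `1, ω + 1, ω ^ 2 + 1, …`. -/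
noncomputable def tower : ℕ → Ordinal.{u}
  | 0 => 1
  | r + 1 => tower r * ω + 1

theorem exists_tower_eq (r : ℕ) : ∃ δ : Ordinal.{u}, tower r = δ + 1 := by
  cases r with
  | zero => exact ⟨0, by simp [tower]⟩
  | succ r => exact ⟨_, rfl⟩

theorem opow_le_tower (r : ℕ) : (ω : Ordinal.{u}) ^ r ≤ tower r := by
  induction r with
  | zero => simp [tower]
  | succ r ih =>
    rw [pow_succ]
    exact (mul_le_mul_left ih ω).trans (le_succ _)

theorem opow_add_one_le_tower {r : ℕ} (hr : 0 < r) : (ω : Ordinal.{u}) ^ r + 1 ≤ tower r := by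
  obtain ⟨r, rfl⟩ := Nat.exists_eq_add_of_lt hr
  simp only [zero_add, tower]
  rw [pow_succ]
  exact add_le_add_left (mul_le_mul_left (opow_le_tower r) ω) 1

/-- `x` is an `r`-fold iterated limit of sequences. -/
def LimRank : ℕ → Ordinal.{u} → Prop
  | 0, _ => True
  | r + 1, x => ∃ y, IsSeqLim y x ∧ ∀ n, LimRank r (y n)

/-- `x` is an `r`-fold iterated limit of sequences of points of colour `i`. -/
def ColorRank {ι : Type v} (c : Ordinal.{u} → ι) (i : ι) : ℕ → Ordinal.{u} → Prop
  | 0, _ => True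
  | r + 1, x => ∃ y, IsSeqLim y x ∧ ∀ n, c (y n) = i ∧ ColorRank c i r (y n)

theorem isSeqLim_mul_natCast {a : Ordinal.{u}} (ha : 0 < a) (z : Ordinal.{u}) :
    IsSeqLim (fun n => z + a * ((n + 1 : ℕ) : Ordinal.{u})) (z + a * ω) := by
  refine ⟨fun m n hmn => ?_, fun n => ?_, fun b hb => ?_⟩
  · simp only [add_lt_add_iff_left]
    exact mul_lt_mul_of_pos_left (by exact_mod_cast Nat.succ_lt_succ hmn) ha
  · simp only [add_lt_add_iff_left]
    exact mul_lt_mul_of_pos_left (natCast_lt_omega0 _) ha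
  · obtain ⟨d, hd, hbd⟩ :=
      (lt_add_iff_of_isSuccLimit (isSuccLimit_mul_right ha isSuccLimit_omega0)).1 hb
    obtain ⟨e, he, hde⟩ := (lt_mul_iff_of_isSuccLimit isSuccLimit_omega0).1 hd
    obtain ⟨n, rfl⟩ := lt_omega0.1 he
    refine ⟨n, hbd.trans ?_⟩
    simp only [add_lt_add_iff_left]
    exact hde.trans (mul_lt_mul_of_pos_left (by exact_mod_cast Nat.lt_succ_self n) ha)

theorem limRank_add_opow (r : ℕ) (z : Ordinal.{u}) : LimRank r (z + ω ^ r) := by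
  induction r generalizing z with
  | zero => trivial
  | succ r ih =>
    rw [pow_succ]
    refine ⟨_, isSeqLim_mul_natCast (pow_pos omega0_pos r) z, fun n => ?_⟩
    rw [Nat.cast_add, Nat.cast_one, mul_add, mul_one, ← add_assoc]
    exact ih _

theorem ColorRank.of_succ {ι : Type v} {c : Ordinal.{u} → ι} {i : ι} {r : ℕ} {x : Ordinal.{u}}
    (h : ColorRank c i (r + 1) x) : ColorRank c i r x := by
  induction r generalizing x with
  | zero => trivial
  | succ r ih =>
    obtain ⟨y, hy, hyc⟩ := h
    exact ⟨y, hy, fun n => ⟨(hyc n).1, ih (hyc n).2⟩⟩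

theorem ColorRank.anti {ι : Type v} {c : Ordinal.{u} → ι} {i : ι} {r s : ℕ} {x : Ordinal.{u}}
    (h : ColorRank c i s x) (hrs : r ≤ s) : ColorRank c i r x := by
  induction s, hrs using Nat.le_induction with
  | base => exact h
  | succ n _ ih => exact ih h.of_succ

/-- For positive rank, points of colour `i` and rank one lower are cofinal below every `y n`, hence
below `x`. -/
theorem ColorRank.of_isSeqLim {ι : Type v} {c : Ordinal.{u} → ι} {i : ι} {r : ℕ}
    {y : ℕ → Ordinal.{u}} {x : Ordinal.{u}} (hy : IsSeqLim y x)
    (h : ∀ n, ColorRank c i r (y n)) : ColorRank c i r x := by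
  cases r with
  | zero => trivial
  | succ r =>
    obtain ⟨z, hz, hzc⟩ := hy.exists_of_cofinal (P := fun z => c z = i ∧ ColorRank c i r z)
      fun b hb => by
        obtain ⟨n, hn⟩ := hy.lub b hb
        obtain ⟨w, hw, hwc⟩ := h n
        obtain ⟨m, hm⟩ := hw.lub b hn
        exact ⟨w m, hm, (hw.lt m).trans (hy.lt n), hwc m⟩
    exact ⟨z, hz, hzc⟩

/-- Along the sequence the colour and the rank vector take finitely many values, so they may be made
constant. In the limit the common colour gains one unit of rank and the other colours keep theirs.
-/
theorem LimRank.exists_colorRank {ι : Type v} [Fintype ι] {c : Ordinal.{u} → ι} {r : ℕ}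
    {x : Ordinal.{u}} (h : LimRank r x) :
    ∃ ρ : ι → ℕ, ∑ i, ρ i = r ∧ ∀ i, ColorRank c i (ρ i) x := by
  classical
  induction r generalizing x with
  | zero => exact ⟨0, by simp, fun i => trivial⟩
  | succ r ih =>
    obtain ⟨y, hy, hyr⟩ := h
    choose ρ hρ hρc using fun n => ih (hyr n)
    have hle : ∀ n i, ρ n i < r + 1 := fun n i => by
      rw [Nat.lt_succ_iff, ← hρ n]
      exact Finset.single_le_sum (f := ρ n) (fun _ _ => Nat.zero_le _) (Finset.mem_univ i)
    obtain ⟨⟨i, σ⟩, hinf⟩ := Finite.exists_infinite_fiber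
      (fun n => ((c (y n), fun i => ⟨ρ n i, hle n i⟩) : ι × (ι → Fin (r + 1))))
    obtain ⟨φ, hφ, hφi⟩ : ∃ φ : ℕ → ℕ, StrictMono φ ∧ ∀ n,
        ((c (y (φ n)), fun i => ⟨ρ (φ n) i, hle (φ n) i⟩) : ι × (ι → Fin (r + 1))) = (i, σ) :=
      ⟨_, Nat.nth_strictMono (Set.infinite_coe_iff.1 hinf),
        fun n => Nat.nth_mem_of_infinite (Set.infinite_coe_iff.1 hinf) n⟩
    have hmem : ∀ n, c (y (φ n)) = i ∧ ∀ j, ρ (φ n) j = σ j := fun n => by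
      have h1 := hφi n
      rw [Prod.mk.injEq] at h1
      exact ⟨h1.1, fun j => congrArg Fin.val (congrFun h1.2 j)⟩
    have hlim := hy.comp hφ
    refine ⟨Function.update (fun j => (σ j : ℕ)) i (σ i + 1), ?_, fun j => ?_⟩
    · have h1 := hρ (φ 0)
      simp only [(hmem 0).2] at h1
      rw [← Finset.sum_add_sum_compl {i} (fun j => (σ j : ℕ)), Finset.sum_singleton,
        Finset.compl_eq_univ_sdiff] at h1
      rw [Finset.sum_update_of_mem (Finset.mem_univ i)]
      lia
    · by_cases hj : j = i
      · subst hj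
        rw [Function.update_self]
        refine ⟨_, hlim, fun n => ⟨(hmem n).1, ?_⟩⟩
        rw [← (hmem n).2]
        exact hρc _ _
      · rw [Function.update_of_ne hj]
        refine ColorRank.of_isSeqLim hlim fun n => ?_
        rw [← (hmem n).2]
        exact hρc _ _

/-- The lower bound `b` lets the copies below successive `y n` be placed in disjoint intervals
before they are joined. -/
theorem ColorRank.exists_normalOn {ι : Type v} {c : Ordinal.{u} → ι} {i : ι} {r : ℕ}
    {x b : Ordinal.{u}} (h : ColorRank c i r x) (hc : c x = i) (hb : b < x) :
    ∃ f, NormalOn f (tower r) ∧ ∀ y < tower r, b < f y ∧ f y ≤ x ∧ c (f y) = i := by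
  induction r generalizing x b with
  | zero =>
    refine ⟨fun _ => x, ⟨fun a b hab hb => ?_, fun l hl hlim => ?_⟩, fun _ _ => ⟨hb, le_rfl, hc⟩⟩
    · rw [tower, Order.lt_one_iff] at hb
      exact absurd hab (by simp [hb])
    · rw [tower, Order.lt_one_iff] at hl
      exact absurd hlim (by simp [hl])
  | succ r ih =>
    obtain ⟨y, hy, hyc⟩ := h
    obtain ⟨m, hlim, hm⟩ := hy.exists_gt hb
    have h1 : ∀ n, y (m + n) < y (m + (n + 1)) := fun n => hlim.mono (Nat.lt_succ_self n)
    choose F hF hFc using fun n => ih (hyc (m + (n + 1))).2 (hyc (m + (n + 1))).1 (h1 n)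
    obtain ⟨δ, hδ⟩ := exists_tower_eq.{u} r
    rw [tower]
    rw [hδ] at hF hFc ⊢
    have hδ1 : δ < δ + 1 := lt_succ δ
    have h0 : (0 : Ordinal) < δ + 1 := zero_le.trans_lt hδ1
    obtain ⟨f, hf, hfF⟩ := exists_normalOn_omega (x := x) hF
      (fun n => (hFc n δ hδ1).2.1.trans_lt (hFc (n + 1) 0 h0).1)
      (fun n => (hFc n δ hδ1).2.1.trans_lt (hlim.lt _))
      (fun b hb => by
        obtain ⟨n, hn⟩ := hlim.lub b hb
        exact ⟨n, hn.trans (hFc n 0 h0).1⟩)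
    refine ⟨f, hf, fun z hz => ?_⟩
    rcases hfF z hz with h | ⟨n, s, hs, h⟩ <;> rw [h]
    · exact ⟨hb, le_rfl, hc⟩
    · obtain ⟨h2, h3, h4⟩ := hFc n s hs
      exact ⟨(hm n).trans h2, h3.trans (hlim.lt _).le, h4⟩

/-- Pigeonhole on the interval `(z, z + ω ^ (∑ i, a i)]`. -/
theorem exists_normalOn_color {ι : Type v} [Fintype ι] (c : Ordinal.{u} → ι) {a : ι → ℕ}
    (ha : ∀ i, 0 < a i) (z : Ordinal.{u}) :
    ∃ i f, NormalOn f (ω ^ a i + 1) ∧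
      ∀ y < ω ^ a i + 1, z < f y ∧ f y ≤ z + ω ^ (∑ i, a i) ∧ c (f y) = i := by
  classical
  have hz : z < z + ω ^ (∑ i, a i) := by simp [pow_pos omega0_pos]
  obtain ⟨ρ, hρ, hρc⟩ := (limRank_add_opow (∑ i, a i) z).exists_colorRank (c := c)
  set x := z + ω ^ (∑ i, a i)
  suffices h : ∃ i, ∃ w ≤ x, z < w ∧ c w = i ∧ ColorRank c i (a i) w by
    obtain ⟨i, w, hwx, hzw, hc, hw⟩ := h
    obtain ⟨f, hf, hfc⟩ := hw.exists_normalOn hc hzw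
    have h1 := opow_add_one_le_tower.{u} (ha i)
    refine ⟨i, f, hf.mono h1, fun y hy => ?_⟩
    obtain ⟨h2, h3, h4⟩ := hfc y (hy.trans_le h1)
    exact ⟨h2, h3.trans hwx, h4⟩
  by_cases h0 : a (c x) ≤ ρ (c x)
  · exact ⟨c x, x, le_rfl, hz, rfl, (hρc _).anti h0⟩
  -- `ρ` and `a` have equal sums, so a deficit at the colour of `x` forces an excess at some `j`.
  -- The spare unit of rank pays for passing from `x` to a point that itself has colour `j`.
  · obtain ⟨j, hj⟩ : ∃ j, a j + 1 ≤ ρ j := by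
      by_contra! hcon
      have : ∑ i, ρ i < ∑ i, a i := Finset.sum_lt_sum (fun i _ => Nat.lt_succ_iff.1 (hcon i))
        ⟨c x, Finset.mem_univ _, not_le.1 h0⟩
      exact this.ne hρ
    obtain ⟨y, hy, hyc⟩ := (hρc j).anti hj
    obtain ⟨m, -, hm⟩ := hy.exists_gt hz
    exact ⟨j, y m, (hy.lt m).le, hm 0, (hyc m).1, (hyc m).2⟩
-- Diagonal sequences and red copies of `ω + 1`
theorem exists_strictMono_of_eventually {U : Filter ℕ} [U.NeBot] (hU : U ≤ atTop)
    {P : ℕ → ℕ → Prop} (h : ∀ᶠ n in U, ∀ᶠ l in U, P n l) :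
    ∃ φ : ℕ → ℕ, StrictMono φ ∧ ∀ s t, s < t → P (φ s) (φ t) := by
  -- The next index must itself be good and lie in the `U`-large sets of all good indices up to `a`;
  -- these are finitely many.
  have step : ∀ a : ℕ, ∃ b, a < b ∧ (∀ᶠ l in U, P b l) ∧
      ∀ n ≤ a, (∀ᶠ l in U, P n l) → P n b := by
    intro a
    have h1 : ∀ᶠ b in U, ∀ n ∈ Iic a, (∀ᶠ l in U, P n l) → P n b := by
      rw [eventually_all_finite (finite_Iic a)]
      intro n _
      by_cases hn : ∀ᶠ l in U, P n l
      · filter_upwards [hn] with b hb _ using hb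
      · exact Eventually.of_forall fun b hb => absurd hb hn
    obtain ⟨b, hb⟩ := ((show ∀ᶠ b in U, a < b from hU (eventually_gt_atTop a)).and (h.and h1)).exists
    exact ⟨b, hb.1, hb.2.1, hb.2.2⟩
  choose g hg hgA hgP using step
  let φ : ℕ → ℕ := fun n => Nat.rec (g 0) (fun _ c => g c) n
  have hφ : StrictMono φ := strictMono_nat_of_lt_succ fun n => hg (φ n)
  have hA : ∀ n, ∀ᶠ l in U, P (φ n) l := by
    intro n
    cases n with
    | zero => exact hgA 0
    | succ n => exact hgA (φ n)
  refine ⟨φ, hφ, fun s t hst => ?_⟩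
  obtain ⟨t, rfl⟩ := Nat.exists_eq_add_of_lt hst
  exact hgP (φ (s + t)) (φ s) (hφ.monotone (Nat.le_add_right _ _)) (hA s)

instance : (hyperfilter ℕ : Filter ℕ).NeBot := (hyperfilter ℕ).neBot

/-- Ramsey's theorem for pairs of natural numbers and two colours. -/
theorem exists_strictMono_homogeneous (P : ℕ → ℕ → Prop) :
    ∃ φ : ℕ → ℕ, StrictMono φ ∧
      ((∀ s t, s < t → P (φ s) (φ t)) ∨ ∀ s t, s < t → ¬ P (φ s) (φ t)) := by
  by_cases h : ∀ᶠ n in (hyperfilter ℕ : Filter ℕ), ∀ᶠ l in (hyperfilter ℕ : Filter ℕ), P n l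
  · obtain ⟨φ, hφ, hP⟩ := exists_strictMono_of_eventually Nat.hyperfilter_le_atTop h
    exact ⟨φ, hφ, Or.inl hP⟩
  -- For an ultrafilter, failing almost everywhere and not holding almost everywhere coincide, so
  -- the negated relation satisfies the same hypothesis.
  · rw [← Ultrafilter.eventually_not] at h
    simp only [← Ultrafilter.eventually_not] at h
    obtain ⟨φ, hφ, hP⟩ := exists_strictMono_of_eventually Nat.hyperfilter_le_atTop h
    exact ⟨φ, hφ, Or.inr hP⟩

/-- A closed copy of `ω + 1` without pairs in `B`. -/
structure IsRedSeq (B : Ordinal.{u} → Ordinal.{u} → Prop) (y : ℕ → Ordinal.{u})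
    (z : Ordinal.{u}) : Prop where
  lim : IsSeqLim y z
  red : ∀ m n, m < n → ¬ B (y m) (y n)
  red_top : ∀ n, ¬ B (y n) z

/-- The finite set `s` has all its pairs in `B`. -/
def IsBlue (B : Ordinal.{u} → Ordinal.{u} → Prop) (s : Finset Ordinal.{u}) : Prop :=
  ∀ x ∈ s, ∀ y ∈ s, x < y → B x y

theorem IsBlue.insert_max {B : Ordinal.{u} → Ordinal.{u} → Prop} {s : Finset Ordinal.{u}}
    (h : IsBlue B s) {x : Ordinal.{u}} (hx : ∀ y ∈ s, y < x ∧ B y x) :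
    IsBlue B (insert x s) ∧ (insert x s).card = s.card + 1 := by
  refine ⟨fun y hy z hz hyz => ?_, Finset.card_insert_of_notMem fun hxs => (hx x hxs).1.false⟩
  rcases Finset.mem_insert.1 hy with rfl | hy' <;> rcases Finset.mem_insert.1 hz with rfl | hz'
  · exact absurd hyz (lt_irrefl _)
  · exact absurd hyz (hx z hz').1.not_gt
  · exact (hx y hy').2
  · exact h y hy' z hz' hyz

theorem IsBlue.insert_min {B : Ordinal.{u} → Ordinal.{u} → Prop} {s : Finset Ordinal.{u}}
    (h : IsBlue B s) {x : Ordinal.{u}} (hx : ∀ y ∈ s, x < y ∧ B x y) :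
    IsBlue B (insert x s) ∧ (insert x s).card = s.card + 1 := by
  refine ⟨fun y hy z hz hyz => ?_, Finset.card_insert_of_notMem fun hxs => (hx x hxs).1.false⟩
  rcases Finset.mem_insert.1 hy with rfl | hy' <;> rcases Finset.mem_insert.1 hz with rfl | hz'
  · exact absurd hyz (lt_irrefl _)
  · exact (hx z hz').2
  · exact absurd hyz (hx y hy').1.not_gt
  · exact h y hy' z hz' hyz

theorem isBlue_image {B : Ordinal.{u} → Ordinal.{u} → Prop} {k : ℕ} {g : Fin k → Ordinal.{u}}
    (hg : StrictMono g) (h : ∀ i j, i < j → B (g i) (g j)) :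
    IsBlue B (Finset.univ.image g) ∧ (Finset.univ.image g).card = k := by
  refine ⟨fun x hx y hy hxy => ?_, by rw [Finset.card_image_of_injective _ hg.injective]; simp⟩
  obtain ⟨i, -, rfl⟩ := Finset.mem_image.1 hx
  obtain ⟨j, -, rfl⟩ := Finset.mem_image.1 hy
  exact h i j (hg.lt_iff_lt.1 hxy)

/-- If points red to `x` are cofinal below `x`, Ramsey's theorem on a sequence of them decides.
Otherwise `x` is blue to a final segment below it, and goes on top of a blue set found there by
induction. -/
theorem LimRank.exists_isRedSeq (B : Ordinal.{u} → Ordinal.{u} → Prop) {k : ℕ}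
    {x b : Ordinal.{u}} (h : LimRank k x) (hb : b < x) :
    (∃ y z, IsRedSeq B y z ∧ z ≤ x ∧ ∀ n, b < y n) ∨
      ∃ s, IsBlue B s ∧ s.card = k + 1 ∧ ∀ w ∈ s, b < w ∧ w ≤ x := by
  induction k generalizing x b with
  | zero =>
    refine Or.inr ⟨{x}, fun y hy z hz hyz => ?_, by simp, by simp [hb]⟩
    rw [Finset.mem_singleton] at hy hz
    exact absurd hyz (by simp [hy, hz])
  | succ k ih =>
    obtain ⟨y, hy, hyk⟩ := h
    by_cases hred : ∀ b' < x, ∃ z, b' < z ∧ z < x ∧ ¬ B z x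
    · obtain ⟨w, hw, hwB⟩ := hy.exists_of_cofinal hred
      obtain ⟨m, hm, hmb⟩ := hw.exists_gt hb
      obtain ⟨φ, hφ, hP | hP⟩ := exists_strictMono_homogeneous
        (fun s t => B (w (m + s)) (w (m + t)))
      · right
        obtain ⟨h1, h2⟩ := isBlue_image (B := B) (k := k + 1 + 1)
          (g := fun i => w (m + φ i)) (fun i j hij => hm.mono (hφ hij))
          (fun i j hij => hP i j hij)
        refine ⟨_, h1, h2, fun v hv => ?_⟩
        obtain ⟨i, -, rfl⟩ := Finset.mem_image.1 hv
        exact ⟨hmb _, (hm.lt _).le⟩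
      · exact Or.inl ⟨_, x, ⟨hm.comp hφ, fun s t hst => hP s t hst, fun n => hwB _⟩, le_rfl,
          fun n => hmb _⟩
    · push Not at hred
      obtain ⟨b', hb', hblue⟩ := hred
      obtain ⟨n, hn⟩ := hy.lub (max b b') (max_lt hb hb')
      rcases ih (hyk n) hn with ⟨w, z, hw, hz, hwb⟩ | ⟨s, hs, hsk, hsb⟩
      · exact Or.inl ⟨w, z, hw, hz.trans (hy.lt n).le,
          fun i => (le_max_left _ _).trans_lt (hwb i)⟩
      · have hlt : ∀ v ∈ s, v < x := fun v hv => (hsb v hv).2.trans_lt (hy.lt n)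
        obtain ⟨h1, h2⟩ := hs.insert_max (x := x) fun v hv =>
          ⟨hlt v hv, hblue v ((le_max_right _ _).trans_lt (hsb v hv).1) (hlt v hv)⟩
        refine Or.inr ⟨_, h1, by rw [h2, hsk], fun v hv => ?_⟩
        rcases Finset.mem_insert.1 hv with rfl | hv
        · exact ⟨hb, le_rfl⟩
        · exact ⟨(le_max_left _ _).trans_lt (hsb v hv).1, (hlt v hv).le⟩

theorem IsBlue.image {B : Ordinal.{u} → Ordinal.{u} → Prop} {h : Ordinal.{u} → Ordinal.{u}}
    {α : Ordinal.{u}} (hh : NormalOn h α) {s : Finset Ordinal.{u}}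
    (hs : IsBlue (fun x y => B (h x) (h y)) s) (hsα : ∀ x ∈ s, x < α) [DecidableEq Ordinal.{u}] :
    IsBlue B (s.image h) ∧ (s.image h).card = s.card := by
  constructor
  · intro x hx y hy hxy
    obtain ⟨z, hz, rfl⟩ := Finset.mem_image.1 hx
    obtain ⟨w, hw, rfl⟩ := Finset.mem_image.1 hy
    exact hs z hz w hw ((hh.lt_iff (hsα z hz) (hsα w hw)).1 hxy)
  · refine Finset.card_image_of_injOn fun x hx y hy hxy => ?_
    rcases lt_trichotomy x y with h | h | h
    · exact absurd hxy (hh.lt h (hsα y hy)).ne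
    · exact h
    · exact absurd hxy (hh.lt h (hsα x hx)).ne'

/-- `ω ^ k + 1 → (ω + 1, k + 1)²`, transported along `h`. -/
theorem exists_isRedSeq_of_normalOn (B : Ordinal.{u} → Ordinal.{u} → Prop) {k : ℕ}
    {h : Ordinal.{u} → Ordinal.{u}} (hh : NormalOn h (ω ^ k + 1)) :
    (∃ y z, IsRedSeq B y z ∧ (∃ w < ω ^ k + 1, z = h w) ∧ ∀ n, ∃ w < ω ^ k + 1, y n = h w) ∨
      ∃ s, IsBlue B s ∧ s.card = k + 1 ∧ ∀ x ∈ s, ∃ w < ω ^ k + 1, x = h w := by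
  classical
  have h1 : LimRank k ((ω : Ordinal.{u}) ^ k) := by simpa using limRank_add_opow.{u} k 0
  have hlt : ∀ w ≤ (ω : Ordinal.{u}) ^ k, w < ω ^ k + 1 := fun w hw => lt_succ_iff.2 hw
  rcases h1.exists_isRedSeq (fun x y => B (h x) (h y)) (pow_pos omega0_pos k) with
    ⟨y, z, hy, hz, -⟩ | ⟨s, hs, hsk, hsb⟩
  · exact Or.inl ⟨_, h z, ⟨hy.lim.map hh (hlt z hz), hy.red, hy.red_top⟩, ⟨z, hlt z hz, rfl⟩,
      fun n => ⟨y n, hlt _ ((hy.lim.lt n).le.trans hz), rfl⟩⟩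
  · obtain ⟨h2, h3⟩ := hs.image hh (fun x hx => hlt x (hsb x hx).2)
    refine Or.inr ⟨_, h2, h3.trans hsk, fun x hx => ?_⟩
    obtain ⟨w, hw, rfl⟩ := Finset.mem_image.1 hx
    exact ⟨w, hlt w (hsb w hw).2, rfl⟩

/-! ### Closed pigeonhole numbers below `ω ^ ω` -/

theorem mul_natCast_add_one_le (a : Ordinal.{u}) {p : ℕ} (hp : 0 < p) :
    a * p + 1 ≤ (a + 1) * p := by
  obtain ⟨q, rfl⟩ := Nat.exists_eq_add_of_lt hp
  rw [zero_add, Nat.cast_add, Nat.cast_one, mul_add, mul_add, mul_one, mul_one, ← add_assoc]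
  exact add_le_add_left (add_le_add_left (mul_le_mul_left (le_succ a) _) a) 1

theorem exists_normalOn_finite_blocks {a : Ordinal.{u}} {p : ℕ} (hp : 0 < p)
    {F : Fin p → Ordinal.{u} → Ordinal.{u}} (hF : ∀ n, NormalOn (F n) (a + 1))
    (hlt : ∀ m n, m < n → F m a < F n 0) :
    ∃ f, NormalOn f (a * p + 1) ∧ ∀ y < a * p + 1, ∃ n, ∃ r < a + 1, f y = F n r := by
  let G : ℕ → Ordinal.{u} → Ordinal.{u} := fun n => if h : n < p then F ⟨n, h⟩ else 0
  have hG : ∀ n (h : n < p), G n = F ⟨n, h⟩ := fun n h => dif_pos h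
  have hcast : ∀ n : ℕ, (n : Ordinal.{u}) < p → n < p := fun n h => by exact_mod_cast h
  have h1 := NormalOn.blocks (δ := a) (η := p) (F := G) (natCast_lt_omega0 p).le
    (fun n hn => by rw [hG n (hcast n hn)]; exact hF _)
    (fun n hn => by
      have h2 := hcast _ hn
      rw [hG _ h2, hG n (Nat.lt_of_succ_lt h2)]
      exact hlt _ _ (Fin.mk_lt_mk.2 (Nat.lt_succ_self n)))
  have hle := mul_natCast_add_one_le a hp
  refine ⟨_, h1.mono hle, fun y hy => ?_⟩
  obtain ⟨n, hn, r, hr, rfl⟩ := exists_block (natCast_lt_omega0 p).le (hy.trans_le hle)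
  exact ⟨⟨n, hcast n hn⟩, r, hr, by rw [blockMap_apply a G n hr, hG n (hcast n hn)]⟩

/-- The closed pigeonhole relation for `ω ^ a i * p i + 1`. -/
theorem closedArrow_one_mul {ι : Type v} [Fintype ι] [Inhabited ι] {a p : ι → ℕ}
    (ha : ∀ i, 0 < a i) (hp : ∀ i, 0 < p i) {M : ℕ} (hM : ∑ i, (p i - 1) < M) :
    ClosedArrow ((ω : Ordinal.{u}) ^ (∑ i, a i) * M + 1) 1
      (fun i => (ω : Ordinal.{u}) ^ a i * p i + 1) := by
  classical
  rw [closedArrow_one_iff]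
  intro c
  -- Each of the `M` consecutive half-open intervals holds a copy in some colour. As `M` exceeds the
  -- sum of the `p i - 1`, some colour `i` occurs in at least `p i` of them.
  choose j f hf hfc using fun t : ℕ =>
    exists_normalOn_color c ha ((ω : Ordinal.{u}) ^ (∑ i, a i) * t)
  obtain ⟨i, hi⟩ : ∃ i, p i ≤ ((Finset.range M).filter (fun t => j t = i)).card := by
    by_contra! hcon
    have h1 := Finset.card_eq_sum_card_fiberwise (f := j) (s := Finset.range M)
      (t := Finset.univ) (fun _ _ => by simp)
    have h2 : ∑ i, ((Finset.range M).filter (fun t => j t = i)).card ≤ ∑ i, (p i - 1) :=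
      Finset.sum_le_sum fun i _ => Nat.le_sub_one_of_lt (hcon i)
    rw [Finset.card_range] at h1
    lia
  obtain ⟨T, hT, hTc⟩ := Finset.exists_subset_card_eq hi
  let e := T.orderEmbOfFin hTc
  have he : ∀ n, e n < M ∧ j (e n) = i := fun n => by
    simpa using hT (T.orderEmbOfFin_mem hTc n)
  have hlast : (ω : Ordinal.{u}) ^ a i < ω ^ a i + 1 := lt_succ _
  have hfirst : (0 : Ordinal.{u}) < ω ^ a i + 1 := zero_le.trans_lt hlast
  have hstep : ∀ s t : ℕ, s < t →
      (ω : Ordinal.{u}) ^ (∑ i, a i) * s + ω ^ (∑ i, a i) ≤ ω ^ (∑ i, a i) * t := by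
    intro s t hst
    rw [← mul_add_one]
    exact mul_le_mul_right (by exact_mod_cast Nat.succ_le_of_lt hst) _
  have hF : ∀ n, NormalOn (f (e n)) (ω ^ a i + 1) := fun n => by
    have := hf (e n); rwa [(he n).2] at this
  have hFc : ∀ n, ∀ y < (ω : Ordinal.{u}) ^ a i + 1, ω ^ (∑ i, a i) * (e n : Ordinal.{u}) < f (e n) y ∧
      f (e n) y ≤ ω ^ (∑ i, a i) * (e n : Ordinal.{u}) + ω ^ (∑ i, a i) ∧ c (f (e n) y) = i :=
    fun n => by
      have := hfc (e n); rwa [(he n).2] at this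
  obtain ⟨g, hg, hgF⟩ := exists_normalOn_finite_blocks (hp i) (F := fun n => f (e n)) hF
    (fun m n hmn => ((hFc m _ hlast).2.1.trans (hstep _ _ (e.strictMono hmn))).trans_lt
      (hFc n 0 hfirst).1)
  refine ⟨i, g, hg, fun x hx => ?_⟩
  obtain ⟨n, r, hr, hgx⟩ := hgF x hx
  obtain ⟨h1, h2, h3⟩ := hFc n r hr
  rw [hgx]
  exact ⟨lt_succ_iff.2 (h2.trans (hstep _ _ (he n).1)), h3⟩

theorem ClosedArrow.one_anti {β : Ordinal.{u}} {ι : Type v} [Inhabited ι] {α α' : ι → Ordinal.{u}}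
    (h : ClosedArrow β 1 α) (hα : ∀ i, α' i ≤ α i) : ClosedArrow β 1 α' := by
  rw [closedArrow_one_iff] at h ⊢
  intro c
  obtain ⟨i, f, hf, hfc⟩ := h c
  exact ⟨i, f, hf.mono (hα i), fun x hx => hfc x (hx.trans_le (hα i))⟩

theorem exists_lt_opow {α : Ordinal.{u}} (h : α < ω ^ (ω : Ordinal.{u})) :
    ∃ n : ℕ, α < ω ^ (n + 1) := by
  rw [lt_opow_of_isSuccLimit omega0_ne_zero isSuccLimit_omega0] at h
  obtain ⟨b, hb, hα⟩ := h
  obtain ⟨n, rfl⟩ := lt_omega0.1 hb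
  refine ⟨n, hα.trans_le ?_⟩
  rw [opow_natCast]
  exact pow_le_pow_right₀ one_lt_omega0.le n.le_succ

theorem pow_mul_add_one_lt (n M : ℕ) :
    (ω : Ordinal.{u}) ^ n * M + 1 < ω ^ (ω : Ordinal.{u}) := by
  have h := opow_mul_lt_opow (natCast_lt_omega0.{u} M) (natCast_lt_omega0.{u} n)
  rw [opow_natCast] at h
  exact (isSuccLimit_opow one_lt_omega0 isSuccLimit_omega0).succ_lt h

/-- Each target is bounded by some `ω ^ (n + 1)`, so a single interval (`p = 1`, `M = 1`) suffices.
-/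
theorem exists_closedArrow_one {α₀ α₁ α₂ : Ordinal.{u}} (h₀ : α₀ < ω ^ (ω : Ordinal.{u}))
    (h₁ : α₁ < ω ^ (ω : Ordinal.{u})) (h₂ : α₂ < ω ^ (ω : Ordinal.{u})) :
    ∃ β < (ω : Ordinal.{u}) ^ (ω : Ordinal.{u}), ClosedArrow β 1 ![α₀, α₁, α₂] := by
  obtain ⟨a, ha⟩ := exists_lt_opow h₀
  obtain ⟨b, hb⟩ := exists_lt_opow h₁
  obtain ⟨c, hc⟩ := exists_lt_opow h₂
  have := closedArrow_one_mul.{u} (ι := Fin 3) (a := ![a + 1, b + 1, c + 1]) (p := 1) (M := 1)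
    (by intro i; fin_cases i <;> simp) (by simp) (by simp)
  refine ⟨_, pow_mul_add_one_lt _ _, this.one_anti fun i => ?_⟩
  fin_cases i
  · simpa using ha.le.trans (le_succ _)
  · simpa using hb.le.trans (le_succ _)
  · simpa using hc.le.trans (le_succ _)

theorem closedArrow_Pcl {α₀ α₁ α₂ β : Ordinal.{u}} (h : ClosedArrow β 1 ![α₀, α₁, α₂]) :
    ClosedArrow (Pcl α₀ α₁ α₂) 1 ![α₀, α₁, α₂] ∧ Pcl α₀ α₁ α₂ ≤ β :=
  ⟨csInf_mem (s := {β | ClosedArrow β 1 ![α₀, α₁, α₂]}) ⟨β, h⟩,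
    csInf_le' (s := {β | ClosedArrow β 1 ![α₀, α₁, α₂]}) h⟩

theorem closedArrow_Rcl {α β : Ordinal.{u}} {k : ℕ}
    (h : ClosedArrow β 2 ![α, (k : Ordinal.{u})]) :
    ClosedArrow (Rcl α k) 2 ![α, (k : Ordinal.{u})] ∧ Rcl α k ≤ β :=
  ⟨csInf_mem (s := {β | ClosedArrow β 2 ![α, (k : Ordinal.{u})]}) ⟨β, h⟩,
    csInf_le' (s := {β | ClosedArrow β 2 ![α, (k : Ordinal.{u})]}) h⟩
-- Chains of red copies and the recursive bound
/-- Inside `S` there is a closed copy of `α` without pairs in `B`, or a set of `k` points with all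
pairs in `B`. -/
def HasHomogeneous (B : Ordinal.{u} → Ordinal.{u} → Prop) (α : Ordinal.{u}) (k : ℕ)
    (S : Set Ordinal.{u}) : Prop :=
  (∃ f, NormalOn f α ∧ (∀ x < α, f x ∈ S) ∧ ∀ x y, x < y → y < α → ¬ B (f x) (f y)) ∨
    ∃ s, IsBlue B s ∧ s.card = k ∧ ∀ x ∈ s, x ∈ S

theorem HasHomogeneous.mono {B : Ordinal.{u} → Ordinal.{u} → Prop} {α : Ordinal.{u}} {k : ℕ}
    {S T : Set Ordinal.{u}} (h : HasHomogeneous B α k S) (hST : S ⊆ T) :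
    HasHomogeneous B α k T := by
  rcases h with ⟨f, hf, hfS, hB⟩ | ⟨s, hs, hsk, hsS⟩
  · exact Or.inl ⟨f, hf, fun x hx => hST (hfS x hx), hB⟩
  · exact Or.inr ⟨s, hs, hsk, fun x hx => hST (hsS x hx)⟩

/-- `N` consecutive closed copies of `ω + 1` in `S`, each without pairs in `B`, such that later
points are `B`-unrelated to the top and to almost all points of each earlier copy. -/
structure IsRedChain (B : Ordinal.{u} → Ordinal.{u} → Prop) (N : ℕ) (S : Set Ordinal.{u})
    (x : ℕ → ℕ → Ordinal.{u}) (top : ℕ → Ordinal.{u}) : Prop where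
  seq : ∀ j < N, IsRedSeq B (x j) (top j)
  mem : ∀ j < N, ∀ n, x j n ∈ S
  top_mem : ∀ j < N, top j ∈ S
  cross : ∀ i j, i < j → j < N → ∀ y, (y = top j ∨ ∃ n, y = x j n) →
    top i < y ∧ ¬ B (top i) y ∧ ∀ᶠ n in (hyperfilter ℕ : Filter ℕ), ¬ B (x i n) y

theorem IsRedChain.cons {B : Ordinal.{u} → Ordinal.{u} → Prop} {N : ℕ} {S T : Set Ordinal.{u}}
    {x : ℕ → ℕ → Ordinal.{u}} {top : ℕ → Ordinal.{u}} (h : IsRedChain B N T x top) (hTS : T ⊆ S)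
    {y : ℕ → Ordinal.{u}} {z : Ordinal.{u}} (hy : IsRedSeq B y z) (hyS : ∀ n, y n ∈ S)
    (hzS : z ∈ S)
    (hT : ∀ w ∈ T, z < w ∧ ¬ B z w ∧ ∀ᶠ n in (hyperfilter ℕ : Filter ℕ), ¬ B (y n) w) :
    IsRedChain B (N + 1) S (fun j => Nat.casesOn j y x) (fun j => Nat.casesOn j z top) := by
  refine ⟨fun j hj => ?_, fun j hj n => ?_, fun j hj => ?_, fun i j hij hj w hw => ?_⟩
  · cases j with
    | zero => exact hy
    | succ j => exact h.seq j (Nat.lt_of_succ_lt_succ hj)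
  · cases j with
    | zero => exact hyS n
    | succ j => exact hTS (h.mem j (Nat.lt_of_succ_lt_succ hj) n)
  · cases j with
    | zero => exact hzS
    | succ j => exact hTS (h.top_mem j (Nat.lt_of_succ_lt_succ hj))
  · cases j with
    | zero => exact absurd hij (Nat.not_lt_zero _)
    | succ j =>
      have hj' := Nat.lt_of_succ_lt_succ hj
      cases i with
      | zero =>
        refine hT w ?_
        rcases hw with rfl | ⟨n, rfl⟩
        · exact h.top_mem j hj'
        · exact h.mem j hj' n
      | succ i => exact h.cross i j (Nat.lt_of_succ_lt_succ hij) hj' w hw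

theorem exists_isRedChain (B : Ordinal.{u} → Ordinal.{u} → Prop) {α ρ : Ordinal.{u}} {k : ℕ}
    {γ : ℕ → Ordinal.{u}} (hρ : PairArrow ρ α k)
    (hγ : ∀ i, ClosedArrow (γ (i + 1)) 1 ![ρ, ρ, ω ^ k + 1 + γ i]) (i : ℕ)
    {h : Ordinal.{u} → Ordinal.{u}} (hh : NormalOn h (ω ^ k + 1 + γ i)) :
    HasHomogeneous B α (k + 1) (h '' Iio (ω ^ k + 1 + γ i)) ∨
      ∃ x top, IsRedChain B (i + 1) (h '' Iio (ω ^ k + 1 + γ i)) x top := by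
  classical
  induction i generalizing h with
  | zero =>
    have hle : (ω : Ordinal.{u}) ^ k + 1 ≤ ω ^ k + 1 + γ 0 := le_self_add
    rcases exists_isRedSeq_of_normalOn B (hh.mono hle) with
      ⟨y, z, hy, ⟨w, hw, rfl⟩, hyw⟩ | ⟨s, hs, hsk, hsw⟩
    · refine Or.inr ⟨fun _ => y, fun _ => h w, fun j _ => hy, fun j _ n => ?_, fun j _ => ?_,
        fun i j hij hj => absurd (hij.trans_le (Nat.lt_succ_iff.1 hj)) (Nat.not_lt_zero _)⟩
      · obtain ⟨v, hv, hyv⟩ := hyw n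
        exact ⟨v, hv.trans_le hle, hyv.symm⟩
      · exact ⟨w, hw.trans_le hle, rfl⟩
    · refine Or.inl (Or.inr ⟨s, hs, hsk, fun x hx => ?_⟩)
      obtain ⟨v, hv, rfl⟩ := hsw x hx
      exact ⟨v, hv.trans_le hle, rfl⟩
  | succ i ih =>
    set S := h '' Iio (ω ^ k + 1 + γ (i + 1))
    have hle : (ω : Ordinal.{u}) ^ k + 1 ≤ ω ^ k + 1 + γ (i + 1) := le_self_add
    have hS : ∀ v < (ω : Ordinal.{u}) ^ k + 1, h v ∈ S := fun v hv => ⟨v, hv.trans_le hle, rfl⟩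
    have hadd : ∀ v < γ (i + 1), ω ^ k + 1 + v < ω ^ k + 1 + γ (i + 1) := fun v hv => by
      simpa using hv
    have hg : NormalOn (fun v => h (ω ^ k + 1 + v)) (γ (i + 1)) :=
      hh.comp (normalOn_add _ _) hadd
    have hgS : ∀ v < γ (i + 1), h (ω ^ k + 1 + v) ∈ S := fun v hv => ⟨_, hadd v hv, rfl⟩
    have hlt : ∀ v < (ω : Ordinal.{u}) ^ k + 1, ∀ w < γ (i + 1), h v < h (ω ^ k + 1 + w) :=
      fun v hv w hw => hh.lt (hv.trans_le le_self_add) (hadd w hw)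
    rcases exists_isRedSeq_of_normalOn B (hh.mono hle) with
      ⟨y, z, hy, ⟨w, hw, rfl⟩, hyw⟩ | ⟨s, hs, hsk, hsw⟩
    -- Colour 0: blue to the top `h w`. Colour 1: blue to almost all `y n`. Colour 2: neither, which
    -- is what the rest of the chain requires.
    · obtain ⟨j, f, hf, hfc⟩ := closedArrow_one_iff.1 (hγ i) (fun v =>
        if B (h w) (h (ω ^ k + 1 + v)) then 0 else
          if ∀ᶠ n in (hyperfilter ℕ : Filter ℕ), B (y n) (h (ω ^ k + 1 + v)) then 1 else 2)
      have hyS : ∀ n, y n ∈ S := fun n => by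
        obtain ⟨v, hv, hyv⟩ := hyw n
        rw [hyv]; exact hS v hv
      have hylt : ∀ n, ∀ v < γ (i + 1), y n < h (ω ^ k + 1 + v) := fun n v hv => by
        obtain ⟨v', hv', hyv⟩ := hyw n
        rw [hyv]; exact hlt _ hv' _ hv
      fin_cases j
      · change NormalOn f ρ at hf
        change ∀ x < ρ, _ at hfc
        rcases hρ.map (hg.comp hf fun x hx => (hfc x hx).1) B with
          ⟨e, he, heS, heB⟩ | ⟨s, hsk, hsS, hs⟩
        · refine Or.inl (Or.inl ⟨e, he, fun x hx => ?_, heB⟩)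
          obtain ⟨v, hv, hev⟩ := heS x hx
          rw [hev]; exact hgS _ (hfc v hv).1
        · have hsw : ∀ x ∈ s, h w < x ∧ B (h w) x := by
            intro x hx
            obtain ⟨v, hv, rfl⟩ := hsS x hx
            obtain ⟨h1, h2⟩ := hfc v hv
            refine ⟨hlt _ hw _ h1, ?_⟩
            by_contra hB
            rw [if_neg hB] at h2
            split_ifs at h2 <;> simp at h2
          obtain ⟨h1, h2⟩ := IsBlue.insert_min (B := B) (s := s) hs hsw
          refine Or.inl (Or.inr ⟨_, h1, by rw [h2, hsk], fun x hx => ?_⟩)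
          rcases Finset.mem_insert.1 hx with rfl | hx
          · exact hS w hw
          · obtain ⟨v, hv, rfl⟩ := hsS x hx
            exact hgS _ (hfc v hv).1
      · change NormalOn f ρ at hf
        change ∀ x < ρ, _ at hfc
        rcases hρ.map (hg.comp hf fun x hx => (hfc x hx).1) B with
          ⟨e, he, heS, heB⟩ | ⟨s, hsk, hsS, hs⟩
        · refine Or.inl (Or.inl ⟨e, he, fun x hx => ?_, heB⟩)
          obtain ⟨v, hv, hev⟩ := heS x hx
          rw [hev]; exact hgS _ (hfc v hv).1
        · have hsw : ∀ x ∈ s, ∀ᶠ n in (hyperfilter ℕ : Filter ℕ), y n < x ∧ B (y n) x := by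
            intro x hx
            obtain ⟨v, hv, rfl⟩ := hsS x hx
            obtain ⟨h1, h2⟩ := hfc v hv
            split_ifs at h2 with h3 h4
            · simp at h2
            · exact h4.mono fun n hn => ⟨hylt n _ h1, hn⟩
            · simp at h2
          -- Finitely many ultrafilter sets meet, so one `y n` is blue to all of `s`.
          obtain ⟨n, hn⟩ := ((eventually_all_finset s).2 hsw).exists
          obtain ⟨h1, h2⟩ := IsBlue.insert_min (B := B) (s := s) hs hn
          refine Or.inl (Or.inr ⟨_, h1, by rw [h2, hsk], fun x hx => ?_⟩)
          rcases Finset.mem_insert.1 hx with rfl | hx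
          · exact hyS n
          · obtain ⟨v, hv, rfl⟩ := hsS x hx
            exact hgS _ (hfc v hv).1
      · change NormalOn f (ω ^ k + 1 + γ i) at hf
        change ∀ x < ω ^ k + 1 + γ i, _ at hfc
        have hsub : (fun v => h (ω ^ k + 1 + f v)) '' Iio (ω ^ k + 1 + γ i) ⊆ S := by
          rintro _ ⟨v, hv, rfl⟩
          exact hgS _ (hfc v hv).1
        rcases ih (hg.comp hf fun x hx => (hfc x hx).1) with h1 | ⟨x, top, hchain⟩
        · exact Or.inl (h1.mono hsub)
        · refine Or.inr ⟨_, _, hchain.cons hsub hy hyS (hS w hw) ?_⟩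
          rintro _ ⟨v, hv, rfl⟩
          obtain ⟨h1, h2⟩ := hfc v hv
          split_ifs at h2 with h3 h4
          · simp at h2
          · simp at h2
          · exact ⟨hlt _ hw _ h1, h3, Ultrafilter.eventually_not.2 h4⟩
    · refine Or.inl (Or.inr ⟨s, hs, hsk, fun x hx => ?_⟩)
      obtain ⟨v, hv, rfl⟩ := hsw x hx
      exact hS v hv

theorem IsRedChain.hasHomogeneous {B : Ordinal.{u} → Ordinal.{u} → Prop} {N m k : ℕ}
    {S : Set Ordinal.{u}} {x : ℕ → ℕ → Ordinal.{u}} {top : ℕ → Ordinal.{u}}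
    (h : IsRedChain B N S x top) (hm : 0 < m)
    (hD : ∀ D : Digraph (Fin N), (∀ i j, D.Adj i j → i < j) →
      HasIndependentSet D m ∨ HasTransitiveTournament D k) :
    HasHomogeneous B (ω * m + 1) k S := by
  classical
  -- An edge records that a pair from the two copies is blue when the index in the later copy is
  -- taken generically after the one in the earlier copy.
  let D : Digraph (Fin N) := ⟨fun i j => i < j ∧ ∀ᶠ n in (hyperfilter ℕ : Filter ℕ),
    ∀ᶠ l in (hyperfilter ℕ : Filter ℕ), B (x i n) (x j l)⟩
  have hDadj : ∀ i j, D.Adj i j ↔ i < j ∧ ∀ᶠ n in (hyperfilter ℕ : Filter ℕ),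
    ∀ᶠ l in (hyperfilter ℕ : Filter ℕ), B (x i n) (x j l) := fun _ _ => Iff.rfl
  -- Along `φ`, pairs whose later index lies in the earlier copy are red, as are pairs with `top j`;
  -- in the opposite arrangement the digraph decides.
  obtain ⟨φ, hφ, hP⟩ := exists_strictMono_of_eventually Nat.hyperfilter_le_atTop
    (P := fun n l => ∀ i j : Fin N, i < j → ¬ B (x i l) (x j n) ∧
      (D.Adj i j → B (x i n) (x j l)) ∧ (¬ D.Adj i j → ¬ B (x i n) (x j l)) ∧
      ¬ B (x i l) (top j)) (by
    have key : ∀ i j : Fin N, i < j → ∀ᶠ n in (hyperfilter ℕ : Filter ℕ),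
        ∀ᶠ l in (hyperfilter ℕ : Filter ℕ), ¬ B (x i l) (x j n) ∧
      (D.Adj i j → B (x i n) (x j l)) ∧ (¬ D.Adj i j → ¬ B (x i n) (x j l)) ∧
      ¬ B (x i l) (top j) := by
      intro i j hij
      have h1 : ∀ n, ∀ᶠ l in (hyperfilter ℕ : Filter ℕ), ¬ B (x i l) (x j n) := fun n =>
        (h.cross i j hij j.2 _ (Or.inr ⟨n, rfl⟩)).2.2
      have h2 := (h.cross i j hij j.2 _ (Or.inl rfl)).2.2
      by_cases hE : D.Adj i j
      · filter_upwards [((hDadj i j).1 hE).2] with n hn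
        filter_upwards [h1 n, h2, hn] with l hl1 hl2 hl3
        exact ⟨hl1, fun _ => hl3, fun h => absurd hE h, hl2⟩
      · have h3 := hE
        rw [hDadj, and_iff_right hij, ← Ultrafilter.eventually_not] at h3
        filter_upwards [h3] with n hn
        filter_upwards [h1 n, h2, Ultrafilter.eventually_not.2 hn] with l hl1 hl2 hl3
        exact ⟨hl1, fun h => absurd h hE, fun _ => hl3, hl2⟩
    have h2 : ∀ᶠ n in (hyperfilter ℕ : Filter ℕ), ∀ i j : Fin N, i < j →
        ∀ᶠ l in (hyperfilter ℕ : Filter ℕ), ¬ B (x i l) (x j n) ∧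
      (D.Adj i j → B (x i n) (x j l)) ∧ (¬ D.Adj i j → ¬ B (x i n) (x j l)) ∧
      ¬ B (x i l) (top j) := by
      simp only [eventually_all]
      exact key
    filter_upwards [h2] with n hn
    simpa only [eventually_all] using hn)
  rcases hD D (fun i j hij => hij.1) with ⟨f, hf, hfD⟩ | ⟨f, hf, hfD⟩
  · left
    let T := Finset.univ.image f
    have hT : T.card = m := by simp [T, Finset.card_image_of_injective _ hf]
    let e := T.orderEmbOfFin hT
    have heD : ∀ s t, ¬ D.Adj (e s) (e t) := fun s t => by
      obtain ⟨a, -, ha⟩ := Finset.mem_image.1 (T.orderEmbOfFin_mem hT s)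
      obtain ⟨b, -, hb⟩ := Finset.mem_image.1 (T.orderEmbOfFin_mem hT t)
      change ¬ D.Adj (T.orderEmbOfFin hT s) (T.orderEmbOfFin hT t)
      rw [← ha, ← hb]
      exact hfD a b
    -- Residues modulo `N` give the copies disjoint index sets, since `hP` says nothing about equal
    -- indices. The shift `n + 1` keeps indices positive, as the clause on `top j` needs a smaller
    -- index.
    let ψ : Fin N → ℕ → ℕ := fun i n => N * (n + 1) + i
    have hψpos : ∀ i n, 0 < ψ i n := fun i n =>
      Nat.add_pos_left (Nat.mul_pos i.pos n.succ_pos) _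
    have hψ : ∀ i, StrictMono (ψ i) := fun i a b hab => by
      simpa [ψ] using Nat.mul_lt_mul_of_pos_left (Nat.succ_lt_succ hab) i.pos
    have hψne : ∀ i j a b, ψ i a = ψ j b → i = j := fun i j a b hab => by
      have := congrArg (· % N) hab
      simp only [ψ, Nat.mul_add_mod, Nat.mod_eq_of_lt i.2, Nat.mod_eq_of_lt j.2] at this
      exact Fin.ext this
    have hseq : ∀ i : Fin N, IsSeqLim (fun n => x i (φ (ψ i n))) (top i) := fun i =>
      (h.seq i i.2).lim.comp (hφ.comp (hψ i))
    choose F hF hFn hFω using fun i => (hseq i).exists_normalOn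
    have hpt : ∀ i : Fin N, ∀ r < (ω : Ordinal.{u}) + 1,
        F i r = top i ∨ ∃ n, F i r = x i (φ (ψ i n)) := fun i r hr => by
      rcases (Order.lt_add_one_iff.1 hr).eq_or_lt with rfl | hr
      · exact Or.inl (hFω i)
      · obtain ⟨n, rfl⟩ := lt_omega0.1 hr
        exact Or.inr ⟨n, hFn i n⟩
    have hpt' : ∀ i : Fin N, ∀ r < (ω : Ordinal.{u}) + 1,
        F i r = top i ∨ ∃ n, F i r = x i n := fun i r hr =>
      (hpt i r hr).imp_right fun ⟨n, hn⟩ => ⟨_, hn⟩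
    have hlt : ∀ i j : Fin N, i < j → ∀ r < (ω : Ordinal.{u}) + 1, ∀ r' < (ω : Ordinal.{u}) + 1,
        F i r < F j r' := fun i j hij r hr r' hr' => by
      refine lt_of_le_of_lt ?_ (h.cross i j hij j.2 _ (hpt' j r' hr')).1
      rw [← hFω i]
      exact (hF i).le (Order.lt_add_one_iff.1 hr) (lt_succ ω)
    obtain ⟨g, hg, hgF⟩ := exists_normalOn_finite_blocks hm (F := fun s => F (e s))
      (fun s => hF _) (fun s t hst => hlt _ _ (e.strictMono hst) _ (lt_succ ω) _
        (zero_le.trans_lt (lt_succ (ω : Ordinal.{u}))))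
    refine ⟨g, hg, fun y hy => ?_, fun u v huv hv => ?_⟩
    · obtain ⟨s, r, hr, hgy⟩ := hgF y hy
      rw [hgy]
      rcases hpt (e s) r hr with h1 | ⟨n, h1⟩ <;> rw [h1]
      · exact h.top_mem _ (e s).2
      · exact h.mem _ (e s).2 _
    · have hguv := hg.lt huv hv
      obtain ⟨t, r', hr', hgv⟩ := hgF v hv
      obtain ⟨s, r, hr, hgu⟩ := hgF u (huv.trans hv)
      rw [hgu, hgv] at hguv ⊢
      rcases lt_trichotomy s t with hst | rfl | hst
      · have hest := e.strictMono hst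
        rcases hpt (e s) r hr with h1 | ⟨n, h1⟩
        · rw [h1]
          exact (h.cross _ _ hest (e t).2 _ (hpt' (e t) r' hr')).2.1
        · rw [h1]
          rcases hpt (e t) r' hr' with h2 | ⟨n', h2⟩ <;> rw [h2]
          · exact (hP _ _ (hψpos (e s) n) _ _ hest).2.2.2
          · rcases lt_trichotomy (ψ (e s) n) (ψ (e t) n') with h3 | h3 | h3
            · exact (hP _ _ h3 _ _ hest).2.2.1 (heD s t)
            · exact absurd (hψne _ _ _ _ h3) hest.ne
            · exact (hP _ _ h3 _ _ hest).1
      · have hrr' := ((hF (e s)).lt_iff hr hr').1 hguv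
        have hrω : r < ω := hrr'.trans_le (Order.lt_add_one_iff.1 hr')
        obtain ⟨n, rfl⟩ := lt_omega0.1 hrω
        rw [hFn]
        rcases (Order.lt_add_one_iff.1 hr').eq_or_lt with rfl | hr'
        · rw [hFω]
          exact (h.seq _ (e s).2).red_top _
        · obtain ⟨n', rfl⟩ := lt_omega0.1 hr'
          rw [hFn]
          exact (h.seq _ (e s).2).red _ _ (hφ (hψ _ (by exact_mod_cast hrr')))
      · exact absurd hguv (hlt _ _ (e.strictMono hst) _ hr' _ hr).not_gt
  · right
    -- Edges go upward, so the tournament is listed in increasing order. Taking index `φ t` in the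
    -- `t`-th copy makes every pair fall under the clause decided by the digraph.
    have hfm : StrictMono f := fun s t hst => (hfD s t hst).1
    obtain ⟨h1, h2⟩ := isBlue_image (B := B) (g := fun t : Fin k => x (f t) (φ t))
      (fun s t hst => ((h.seq _ (f s).2).lim.lt _).trans
        (h.cross _ _ (hfm hst) (f t).2 _ (Or.inr ⟨_, rfl⟩)).1)
      (fun s t hst => (hP _ _ hst _ _ (hfm hst)).2.1 (hfD s t hst))
    refine ⟨_, h1, h2, fun y hy => ?_⟩
    obtain ⟨t, -, rfl⟩ := Finset.mem_image.1 hy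
    exact h.mem _ (f t).2 _

/-- The recursive upper bound. -/
theorem pairArrow_succ {ρ : Ordinal.{u}} {k m N : ℕ} (hm : 0 < m)
    {γ : ℕ → Ordinal.{u}} (hρ : PairArrow ρ (ω * m + 1) k)
    (hγ : ∀ i, ClosedArrow (γ (i + 1)) 1 ![ρ, ρ, ω ^ k + 1 + γ i])
    (hD : ∀ D : Digraph (Fin (N + 1)), (∀ i j, D.Adj i j → i < j) →
      HasIndependentSet D m ∨ HasTransitiveTournament D (k + 1)) :
    PairArrow (ω ^ k + 1 + γ N) (ω * m + 1) (k + 1) := by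
  intro B
  have key : HasHomogeneous B (ω * m + 1) (k + 1) ((fun x => x) '' Iio (ω ^ k + 1 + γ N)) := by
    rcases exists_isRedChain B hρ hγ N (normalOn_id _) with h | ⟨x, top, h⟩
    · exact h
    · exact h.hasHomogeneous hm hD
  simp only [image_id'] at key
  rcases key with ⟨f, hf, hfS, hB⟩ | ⟨s, hs, hsk, hsS⟩
  · exact Or.inl ⟨f, hf, hfS, hB⟩
  · exact Or.inr ⟨s, hsk, hsS, hs⟩
-- Topological copies contain closed copies
theorem IsSeqLim.tendsto {y : ℕ → Ordinal.{u}} {x : Ordinal.{u}} (h : IsSeqLim y x) :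
    Tendsto y atTop (𝓝 x) := by
  refine tendsto_order.2 ⟨fun a ha => ?_, fun a ha => Eventually.of_forall fun n =>
    (h.lt n).trans ha⟩
  obtain ⟨n, hn⟩ := h.lub a ha
  filter_upwards [eventually_ge_atTop n] with l hl using hn.trans_le (h.mono.monotone hl)

/-- The neighbourhood of `q` below `succ q` has no point above `q`, so convergence is from below and
an increasing subsequence exists. -/
theorem exists_isSeqLim_of_tendsto {w : ℕ → Ordinal.{u}} {q : Ordinal.{u}}
    (h : Tendsto w atTop (𝓝 q)) (hw : ∀ n, w n ≠ q) :
    ∃ φ : ℕ → ℕ, IsSeqLim (fun n => w (φ n)) q := by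
  have hlt : ∀ᶠ n in atTop, w n < q := by
    filter_upwards [h.eventually (gt_mem_nhds (lt_succ q))] with n hn
    exact lt_of_le_of_ne (lt_succ_iff.1 hn) (hw n)
  obtain ⟨φ, hφ, hP⟩ := exists_strictMono_of_eventually (U := atTop) le_rfl
    (P := fun n l => w n < w l ∧ w l < q) (by
      filter_upwards [hlt] with n hn
      filter_upwards [hlt, h.eventually (lt_mem_nhds hn)] with l h1 h2 using ⟨h2, h1⟩)
  refine ⟨φ, fun s t hst => (hP s t hst).1, fun n => ?_, fun b hb => ?_⟩
  · have := hP n (n + 1) (Nat.lt_succ_self n)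
    exact this.1.trans this.2
  · obtain ⟨n, hn⟩ := eventually_atTop.1 (h.eventually (lt_mem_nhds hb))
    exact ⟨n, hn _ (hφ.id_le n)⟩

/-- A set with `m` limit points contains a closed copy of `ω * m + 1`. -/
theorem exists_normalOn_of_limits {X : Set Ordinal.{u}} {m : ℕ} (hm : 0 < m)
    {q : Fin m → Ordinal.{u}} (hq : Function.Injective q) (hqX : ∀ i, q i ∈ X)
    (hlim : ∀ i, ∃ y, IsSeqLim y (q i) ∧ ∀ n, y n ∈ X) :
    ∃ f, NormalOn f (ω * m + 1) ∧ ∀ x < ω * m + 1, f x ∈ X := by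
  classical
  let T := Finset.univ.image q
  have hT : T.card = m := by simp [T, Finset.card_image_of_injective _ hq]
  let e := T.orderEmbOfFin hT
  have he : ∀ s, ∃ i, q i = e s := fun s => by
    obtain ⟨i, -, hi⟩ := Finset.mem_image.1 (T.orderEmbOfFin_mem hT s)
    exact ⟨i, hi⟩
  have hF : ∀ s, ∃ F : Ordinal.{u} → Ordinal.{u}, NormalOn F (ω + 1) ∧ F ω = e s ∧
      (∀ r < (ω : Ordinal.{u}) + 1, F r ∈ X) ∧ ∀ t < s, e t < F 0 := by
    intro s
    obtain ⟨i, hi⟩ := he s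
    obtain ⟨y, hy, hyX⟩ := hlim i
    rw [hi] at hy
    -- Starting the sequence beyond all smaller limit points separates the `m` copies of `ω + 1`.
    have hb : (Finset.univ.filter (· < s)).sup e < e s := by
      refine (Finset.sup_lt_iff (zero_le.trans_lt (hy.lt 0))).2 fun t ht => ?_
      exact e.strictMono (by simpa using ht)
    obtain ⟨a, ha, hab⟩ := hy.exists_gt hb
    obtain ⟨F, hF, hFn, hFω⟩ := ha.exists_normalOn
    refine ⟨F, hF, hFω, fun r hr => ?_, fun t ht => ?_⟩
    · rcases (Order.lt_add_one_iff.1 hr).eq_or_lt with rfl | hr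
      · rw [hFω, ← hi]; exact hqX i
      · obtain ⟨n, rfl⟩ := lt_omega0.1 hr
        rw [hFn]; exact hyX _
    · have h0 := hFn 0
      rw [Nat.cast_zero] at h0
      rw [h0]
      exact (Finset.le_sup (f := e) (by simpa using ht)).trans_lt (hab 0)
  choose F hF hFω hFX hF0 using hF
  obtain ⟨f, hf, hfF⟩ := exists_normalOn_finite_blocks hm hF
    (fun s t hst => by rw [hFω]; exact hF0 t s hst)
  refine ⟨f, hf, fun x hx => ?_⟩
  obtain ⟨n, r, hr, h⟩ := hfF x hx
  rw [h]
  exact hFX n r hr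

/-- A homeomorphism need not respect order, but it carries the limit points `ω * i + ω` to distinct
points of `X` that are limits of sequences in `X`. Sorting these gives the copy. -/
theorem IsTopCopy.exists_normalOn {X : Set Ordinal.{u}} {m : ℕ} (hm : 0 < m)
    (h : IsTopCopy X (ω * m + 1)) :
    ∃ f, NormalOn f (ω * m + 1) ∧ ∀ x < ω * m + 1, f x ∈ X := by
  obtain ⟨ψ⟩ := h
  have hle : ∀ i : Fin m, (ω : Ordinal.{u}) * i + ω ≤ ω * m := fun i => by
    rw [← mul_add_one]
    exact mul_le_mul_right (by exact_mod_cast Nat.succ_le_of_lt i.2) _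
  have hmem : ∀ i : Fin m, (ω : Ordinal.{u}) * i + ω < ω * m + 1 := fun i => lt_succ_iff.2 (hle i)
  have hs : ∀ i : Fin m, IsSeqLim (fun n : ℕ => (ω : Ordinal.{u}) * i + 1 * ((n + 1 : ℕ) : Ordinal.{u}))
      (ω * i + 1 * ω) := fun i => isSeqLim_mul_natCast one_pos _
  simp only [one_mul] at hs
  refine exists_normalOn_of_limits hm (q := fun i => ψ.symm ⟨ω * (i : ℕ) + ω, hmem i⟩) ?_
    (fun i => (ψ.symm _).2) fun i => ?_
  · intro i j hij
    have h1 := congrArg Subtype.val (ψ.symm.injective (Subtype.ext hij))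
    simp only [← mul_add_one] at h1
    rcases lt_trichotomy i j with h2 | h2 | h2
    · refine absurd h1 (mul_lt_mul_of_pos_left ?_ omega0_pos).ne
      exact_mod_cast Nat.succ_lt_succ h2
    · exact h2
    · refine absurd h1 (mul_lt_mul_of_pos_left ?_ omega0_pos).ne'
      exact_mod_cast Nat.succ_lt_succ h2
  · have hin : ∀ n : ℕ, (ω : Ordinal.{u}) * i + ((n + 1 : ℕ) : Ordinal.{u}) < ω * m + 1 :=
      fun n => ((hs i).lt n).trans (hmem i)
    have h1 : Tendsto (fun n : ℕ => (⟨ω * (i : ℕ) + ((n + 1 : ℕ) : Ordinal.{u}), hin n⟩ :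
        Iio ((ω : Ordinal.{u}) * m + 1))) atTop (𝓝 ⟨ω * (i : ℕ) + ω, hmem i⟩) :=
      tendsto_subtype_rng.2 (hs i).tendsto
    have h2 := ((continuous_subtype_val.comp ψ.symm.continuous).tendsto _).comp h1
    obtain ⟨φ, hφ⟩ := exists_isSeqLim_of_tendsto h2 fun n hn => by
      have h3 := congrArg Subtype.val (ψ.symm.injective (Subtype.ext hn))
      exact ((hs i).lt n).ne h3
    exact ⟨_, hφ, fun n => (ψ.symm _).2⟩

theorem TopArrow.pairArrow {β : Ordinal.{u}} {m k : ℕ} (hm : 0 < m)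
    (h : TopArrow β 2 ![ω * m + 1, (k : Ordinal.{u})]) : PairArrow β (ω * m + 1) k := by
  refine pairArrow_of_coloring fun c => ?_
  obtain ⟨X, i, hX, hc, he⟩ := h c
  fin_cases i
  · obtain ⟨f, hf, hfX⟩ := IsTopCopy.exists_normalOn hm he
    refine Or.inl ⟨f, hf, fun x hx => hX (hfX x hx), fun s hs => hc s (hs.trans ?_)⟩
    rintro _ ⟨x, hx, rfl⟩
    exact hfX x hx
  · obtain ⟨e⟩ := he
    exact Or.inr ⟨X, hX, hc, ⟨e.toEquiv⟩⟩

/-! ### Existence of the digraph Ramsey numbers -/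

theorem exists_list_of_large (m k : ℕ) : ∃ p : ℕ, ∀ (V : Type) (D : Digraph V) (S : Finset V),
    (∀ v, ¬ D.Adj v v) → p ≤ S.card →
    (∃ l : List V, l.length = m ∧ (∀ a ∈ l, a ∈ S) ∧
      l.Pairwise fun a b => a ≠ b ∧ ¬ D.Adj a b ∧ ¬ D.Adj b a) ∨
    ∃ l : List V, l.length = k ∧ (∀ a ∈ l, a ∈ S) ∧ l.Pairwise D.Adj := by
  classical
  induction m generalizing k with
  | zero => exact ⟨0, fun V D S _ _ => Or.inl ⟨[], by simp⟩⟩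
  | succ m ihm =>
    induction k with
    | zero => exact ⟨0, fun V D S _ _ => Or.inr ⟨[], by simp⟩⟩
    | succ k ihk =>
      obtain ⟨p, hp⟩ := ihk
      obtain ⟨r, hr⟩ := ihm (k + 1)
      -- The vertices other than `v` are covered by out-neighbours, in-neighbours and
      -- non-neighbours; `v` goes first in a tournament, last in one, or into an independent set.
      -- The sizes `p`, `p`, `r` and `v` itself add up to the constant.
      refine ⟨2 * p + r + 1, fun V D S hD hS => ?_⟩
      obtain ⟨v, hv⟩ := Finset.card_pos.1 (show 0 < S.card by lia)
      have hcard : S.card - 1 ≤ ((S.erase v).filter (D.Adj v ·)).card +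
          ((S.erase v).filter (D.Adj · v)).card +
          ((S.erase v).filter fun a => ¬ D.Adj v a ∧ ¬ D.Adj a v).card := by
        rw [← Finset.card_erase_of_mem hv]
        refine le_trans (Finset.card_le_card ?_) ((Finset.card_union_le _ _).trans
          (Nat.add_le_add_right (Finset.card_union_le _ _) _))
        intro a ha
        simp only [Finset.mem_union, Finset.mem_filter, ha, true_and]
        tauto
      have hsub : ∀ (P : V → Prop) [DecidablePred P] (l : List V), (∀ a ∈ l, a ∈ (S.erase v).filter P) →
          ∀ a ∈ l, a ∈ S := fun P _ l hl a ha =>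
        Finset.mem_of_mem_erase (Finset.mem_filter.1 (hl a ha)).1
      have hcases : p ≤ ((S.erase v).filter (D.Adj v ·)).card ∨
          p ≤ ((S.erase v).filter (D.Adj · v)).card ∨
          r ≤ ((S.erase v).filter fun a => ¬ D.Adj v a ∧ ¬ D.Adj a v).card := by lia
      rcases hcases with h | h | h
      · rcases hp V D _ hD h with ⟨l, h1, h2, h3⟩ | ⟨l, h1, h2, h3⟩
        · exact Or.inl ⟨l, h1, hsub _ l h2, h3⟩
        · refine Or.inr ⟨v :: l, by simp [h1], by simpa [hv] using hsub _ l h2,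
            List.pairwise_cons.2 ⟨fun a ha => (Finset.mem_filter.1 (h2 a ha)).2, h3⟩⟩
      · rcases hp V D _ hD h with ⟨l, h1, h2, h3⟩ | ⟨l, h1, h2, h3⟩
        · exact Or.inl ⟨l, h1, hsub _ l h2, h3⟩
        · refine Or.inr ⟨l ++ [v], by simp [h1], ?_, ?_⟩
          · intro a ha
            rcases List.mem_append.1 ha with ha | ha
            · exact hsub _ l h2 a ha
            · rw [List.mem_singleton.1 ha]; exact hv
          · refine List.pairwise_append.2 ⟨h3, List.pairwise_singleton _ _, fun a ha b hb => ?_⟩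
            rw [List.mem_singleton.1 hb]
            exact (Finset.mem_filter.1 (h2 a ha)).2
      · rcases hr V D _ hD h with ⟨l, h1, h2, h3⟩ | ⟨l, h1, h2, h3⟩
        · refine Or.inl ⟨v :: l, by simp [h1], by simpa [hv] using hsub _ l h2,
            List.pairwise_cons.2 ⟨fun a ha => ?_, h3⟩⟩
          obtain ⟨h4, h5⟩ := Finset.mem_filter.1 (h2 a ha)
          exact ⟨(Finset.ne_of_mem_erase h4).symm, h5⟩
        · exact Or.inr ⟨l, h1, hsub _ l h2, h3⟩

theorem exists_digraphArrow (m k : ℕ) : ∃ p, 0 < p ∧ DigraphArrow p m k := by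
  obtain ⟨p, hp⟩ := exists_list_of_large m k
  refine ⟨p + 1, p.succ_pos, fun n hn D hD => ?_⟩
  rcases hp (Fin n) D Finset.univ hD (by simp; lia) with ⟨l, rfl, -, h⟩ | ⟨l, rfl, -, h⟩
  · left
    have h1 := List.pairwise_iff_get.1 h
    refine ⟨l.get, fun i j hij => ?_, fun i j => ?_⟩
    · by_contra hne
      rcases lt_or_gt_of_ne hne with h2 | h2
      · exact (h1 _ _ h2).1 hij
      · exact (h1 _ _ h2).1 hij.symm
    · rcases lt_trichotomy i j with h2 | rfl | h2
      · exact (h1 _ _ h2).2.1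
      · exact hD _
      · exact (h1 _ _ h2).2.2
  · right
    have h1 := List.pairwise_iff_get.1 h
    refine ⟨l.get, fun i j hij => ?_, h1⟩
    by_contra hne
    rcases lt_or_gt_of_ne hne with h2 | h2
    · exact hD _ (hij ▸ h1 _ _ h2)
    · exact hD _ (hij ▸ h1 _ _ h2)

theorem digraphRamsey_spec (m k : ℕ) :
    0 < digraphRamsey m k ∧ DigraphArrow (digraphRamsey m k) m k :=
  Nat.sInf_mem (s := {p | 0 < p ∧ DigraphArrow p m k}) (exists_digraphArrow m k)

/-! ### Existence and size of the Ramsey numbers -/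

theorem add_lt_opow_omega0 {a b : Ordinal.{u}} (ha : a < ω ^ (ω : Ordinal.{u}))
    (hb : b < ω ^ (ω : Ordinal.{u})) : a + b < ω ^ (ω : Ordinal.{u}) :=
  isPrincipal_add_omega0_opow _ ha hb

theorem pow_add_one_lt (k : ℕ) : (ω : Ordinal.{u}) ^ k + 1 < ω ^ (ω : Ordinal.{u}) := by
  simpa using pow_mul_add_one_lt.{u} k 1

theorem stepSeq_spec {m k : ℕ} (hR : Rcl.{u} (ω * m + 1) k < ω ^ (ω : Ordinal.{u})) :
    (∀ i, stepSeq.{u} m k i < ω ^ (ω : Ordinal.{u})) ∧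
    ∀ i, ClosedArrow (stepSeq.{u} m k (i + 1)) 1
      ![Rcl (ω * m + 1) k, Rcl (ω * m + 1) k, ω ^ k + 1 + stepSeq m k i] := by
  have key : ∀ i, stepSeq.{u} m k i < ω ^ (ω : Ordinal.{u}) →
      ClosedArrow (stepSeq.{u} m k (i + 1)) 1
        ![Rcl (ω * m + 1) k, Rcl (ω * m + 1) k, ω ^ k + 1 + stepSeq m k i] ∧
      stepSeq.{u} m k (i + 1) < ω ^ (ω : Ordinal.{u}) := fun i hi => by
    obtain ⟨β, hβ, h⟩ := exists_closedArrow_one hR hR (add_lt_opow_omega0 (pow_add_one_lt k) hi)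
    have := closedArrow_Pcl h
    exact ⟨this.1, this.2.trans_lt hβ⟩
  have hlt : ∀ i, stepSeq.{u} m k i < ω ^ (ω : Ordinal.{u}) := fun i => by
    induction i with
    | zero => exact opow_pos _ omega0_pos
    | succ i ih => exact (key i ih).2
  exact ⟨hlt, fun i => (key i (hlt i)).1⟩

/-- The recursive bound at the digraph Ramsey number. -/
theorem pairArrow_digraphRamsey {m k : ℕ} (hm : 0 < m)
    (hRarrow : PairArrow (Rcl.{u} (ω * m + 1) k) (ω * m + 1) k)
    (hR : Rcl.{u} (ω * m + 1) k < ω ^ (ω : Ordinal.{u})) :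
    PairArrow (ω ^ k + 1 + stepSeq.{u} m k (digraphRamsey m (k + 1) - 1)) (ω * m + 1) (k + 1) := by
  obtain ⟨h0, hN⟩ := digraphRamsey_spec m (k + 1)
  refine pairArrow_succ hm hRarrow (stepSeq_spec hR).2 fun D hD => ?_
  exact hN _ (by lia) D fun v hv => (hD v v hv).false

/-- Existence and the bound `ω ^ ω` are proved together, since the pigeonhole numbers of the next
step are obtained only from arguments below `ω ^ ω`. -/
theorem exists_pairArrow {m : ℕ} (hm : 0 < m) (k : ℕ) :
    PairArrow (Rcl.{u} (ω * m + 1) (k + 1)) (ω * m + 1) (k + 1) ∧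
      Rcl.{u} (ω * m + 1) (k + 1) < ω ^ (ω : Ordinal.{u}) := by
  suffices h : ∃ β < (ω : Ordinal.{u}) ^ (ω : Ordinal.{u}), PairArrow β (ω * m + 1) (k + 1) by
    obtain ⟨β, hβ, h⟩ := h
    have := closedArrow_Rcl (closedArrow_of_pairArrow h)
    exact ⟨pairArrow_of_closedArrow this.1, this.2.trans_lt hβ⟩
  induction k with
  | zero =>
    refine ⟨1, ?_, fun B => Or.inr ⟨{0}, by simp, by simp, by simp⟩⟩
    exact one_lt_omega0.trans_le (left_le_opow _ omega0_pos)
  | succ k ih =>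
    obtain ⟨β, hβ, h⟩ := ih
    have h1 := closedArrow_Rcl (closedArrow_of_pairArrow h)
    have h2 := h1.2.trans_lt hβ
    exact ⟨_, add_lt_opow_omega0 (pow_add_one_lt _) ((stepSeq_spec h2).1 _),
      pairArrow_digraphRamsey hm (pairArrow_of_closedArrow h1.1) h2⟩

theorem Rtop_spec {m k : ℕ} (hm : 0 < m) :
    TopArrow (Rtop.{u} (ω * m + 1) (k + 1)) 2 ![ω * m + 1, ((k + 1 : ℕ) : Ordinal.{u})] ∧
      Rtop.{u} (ω * m + 1) (k + 1) = Rcl (ω * m + 1) (k + 1) := by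
  have h1 := closedArrow_of_pairArrow (exists_pairArrow.{u} hm k).1
  have h2 : TopArrow (Rtop.{u} (ω * m + 1) (k + 1)) 2 ![ω * m + 1, ((k + 1 : ℕ) : Ordinal.{u})] :=
    csInf_mem (s := {β | TopArrow β 2 ![ω * m + 1, ((k + 1 : ℕ) : Ordinal.{u})]}) ⟨_, h1.topArrow⟩
  refine ⟨h2, le_antisymm ?_ ?_⟩
  · exact csInf_le' (s := {β | TopArrow β 2 ![ω * m + 1, ((k + 1 : ℕ) : Ordinal.{u})]}) h1.topArrow
  · exact (closedArrow_Rcl (closedArrow_of_pairArrow (h2.pairArrow hm))).2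

/-! ### The case of `ω * 2 + 1` and `3` -/

theorem pairArrow_self_two (α : Ordinal.{u}) : PairArrow α α 2 := by
  intro B
  by_cases h : ∃ x y, x < y ∧ y < α ∧ B x y
  · obtain ⟨x, y, hxy, hy, hB⟩ := h
    refine Or.inr ⟨{x, y}, Finset.card_pair hxy.ne, by simp [hy, hxy.trans hy], ?_⟩
    intro a ha b hb hab
    simp only [Finset.mem_insert, Finset.mem_singleton] at ha hb
    rcases ha with rfl | rfl <;> rcases hb with rfl | rfl
    · exact absurd hab (lt_irrefl _)
    · exact hB
    · exact absurd hab hxy.not_gt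
    · exact absurd hab (lt_irrefl _)
  · exact Or.inl ⟨_, normalOn_id α, fun x hx => hx, fun x y hxy hy hB => h ⟨x, y, hxy, hy, hB⟩⟩

/-- `ω ^ b * M` absorbs the smaller summand on its left, so the term `ω ^ k + 1` of the recursion
costs nothing. -/
theorem pow_add_one_add_le {a b M : ℕ} (hab : a < b) (hM : 0 < M) {x : Ordinal.{u}}
    (hx : x ≤ ω ^ b * M + 1) : ω ^ a + 1 + x ≤ ω ^ b * M + 1 := by
  have key : (ω : Ordinal.{u}) ^ a + 1 + ω ^ b * M = ω ^ b * M := by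
    refine add_of_omega0_opow_le (b := (b : Ordinal.{u})) ?_ ?_ <;> rw [opow_natCast]
    · have hlim : IsSuccLimit ((ω : Ordinal.{u}) ^ b) := by
        have := isSuccLimit_opow_left.{u} isSuccLimit_omega0 (b := (b : Ordinal.{u}))
          (by exact_mod_cast (Nat.zero_le a).trans_lt hab |>.ne')
        rwa [opow_natCast] at this
      exact hlim.succ_lt (pow_lt_pow_right₀ one_lt_omega0 hab)
    · exact le_mul_of_one_le_right' (show (1 : Ordinal.{u}) ≤ M by exact_mod_cast hM)
  refine (add_le_add_right hx _).trans ?_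
  rw [← add_assoc (ω ^ a + 1), key]

theorem Rcl_omega_mul_two_add_one_three_le :
    Rcl.{u} (ω * 2 + 1) 3 ≤ ω ^ 8 * 7 + 1 := by
  have h2 := closedArrow_Rcl (closedArrow_of_pairArrow (pairArrow_self_two (ω * (2 : ℕ) + 1 : Ordinal.{u})))
  have hR : Rcl.{u} (ω * (2 : ℕ) + 1) 2 < ω ^ (ω : Ordinal.{u}) :=
    h2.2.trans_lt (by simpa using pow_mul_add_one_lt.{u} 1 2)
  have bound : ∀ (c r M : ℕ) (x : Ordinal.{u}), 0 < c → 0 < r → r + 1 < M →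
      ω ^ 2 + 1 + x ≤ ω ^ c * r + 1 →
      Pcl (Rcl.{u} (ω * (2 : ℕ) + 1) 2) (Rcl.{u} (ω * (2 : ℕ) + 1) 2) (ω ^ 2 + 1 + x) ≤
        ω ^ (c + 2) * M + 1 := by
    intro c r M x hc hr hM hx
    -- The targets are `ω * 2 + 1` twice and `ω ^ c * r + 1`: the exponents add up to `c + 2`, and
    -- the sum of the `p i - 1` is `r + 1`.
    have h := closedArrow_one_mul.{u} (ι := Fin 3) (a := ![1, 1, c]) (p := ![2, 2, r]) (M := M)
      (by intro i; fin_cases i <;> simp [hc]) (by intro i; fin_cases i <;> simp [hr])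
      (by simp [Fin.sum_univ_three]; lia)
    have h3 : ∑ i, (![1, 1, c] : Fin 3 → ℕ) i = c + 2 := by
      simp [Fin.sum_univ_three]; lia
    rw [h3] at h
    refine (closedArrow_Pcl (h.one_anti fun i => ?_)).2
    fin_cases i
    · simpa using h2.2
    · simpa using h2.2
    · simpa using hx
  have h1 : stepSeq.{u} 2 2 1 ≤ ω ^ 4 * (3 : ℕ) + 1 :=
    bound 2 1 3 0 (by simp) (by simp) (by simp) (by simp)
  have h3 : stepSeq.{u} 2 2 2 ≤ ω ^ 6 * (5 : ℕ) + 1 :=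
    bound 4 3 5 _ (by simp) (by simp) (by simp) (pow_add_one_add_le (by simp) (by simp) h1)
  -- Only digraphs with upward edges occur, so three vertices (`N = 2`) already give a transitive
  -- triangle or a nonadjacent pair, whereas a cyclic triangle has neither. This yields `ω ^ 6 * 5 +
  -- 1`, below the claimed bound.
  have h4 := pairArrow_succ (N := 2) two_pos (pairArrow_of_closedArrow h2.1)
    (stepSeq_spec hR).2 fun D hD => by
      by_cases hall : ∀ i j, i < j → D.Adj i j
      · exact Or.inr ⟨id, Function.injective_id, hall⟩
      · left
        push Not at hall
        obtain ⟨i, j, hij, hadj⟩ := hall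
        refine ⟨![i, j], fun a b hab => ?_, fun a b hab => ?_⟩
        · fin_cases a <;> fin_cases b <;> simp_all [hij.ne, hij.ne']
        · fin_cases a <;> fin_cases b
          · exact (hD _ _ hab).false
          · exact hadj hab
          · exact (hD _ _ hab).not_gt hij
          · exact (hD _ _ hab).false
  have h5 := (closedArrow_Rcl (closedArrow_of_pairArrow h4)).2.trans
    (pow_add_one_add_le (by simp) (by simp) h3)
  refine (show Rcl.{u} (ω * 2 + 1) 3 ≤ ω ^ 6 * 5 + 1 by simpa using h5).trans ?_
  gcongr
  · exact one_lt_omega0.le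
  · simp
  · exact_mod_cast (by simp : 5 ≤ 7)

end OrdinalRamsey

theorem mainTheorem5 :
    (∀ k m : ℕ, 0 < k → 0 < m →
      -- the two Ramsey numbers exist, are equal, and are below `ω ^ ω`
      OrdinalRamsey.TopArrow (OrdinalRamsey.Rtop.{u} (ω * m + 1) (k + 1)) 2
        ![ω * m + 1, ((k + 1 : ℕ) : Ordinal.{u})] ∧
      OrdinalRamsey.ClosedArrow (OrdinalRamsey.Rcl.{u} (ω * m + 1) (k + 1)) 2
        ![ω * m + 1, ((k + 1 : ℕ) : Ordinal.{u})] ∧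
      OrdinalRamsey.Rtop.{u} (ω * m + 1) (k + 1) = OrdinalRamsey.Rcl.{u} (ω * m + 1) (k + 1) ∧
      OrdinalRamsey.Rcl.{u} (ω * m + 1) (k + 1) < (ω : Ordinal.{u}) ^ (ω : Ordinal.{u}) ∧
      -- the numbers used in the recursive bound exist
      (0 < OrdinalRamsey.digraphRamsey m (k + 1) ∧
        OrdinalRamsey.DigraphArrow (OrdinalRamsey.digraphRamsey m (k + 1)) m (k + 1)) ∧
      OrdinalRamsey.ClosedArrow (OrdinalRamsey.Rcl.{u} (ω * m + 1) k) 2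
        ![ω * m + 1, (k : Ordinal.{u})] ∧
      (∀ i : ℕ, OrdinalRamsey.ClosedArrow (OrdinalRamsey.stepSeq.{u} m k (i + 1)) 1
        ![OrdinalRamsey.Rcl.{u} (ω * m + 1) k, OrdinalRamsey.Rcl.{u} (ω * m + 1) k,
          ω ^ k + 1 + OrdinalRamsey.stepSeq.{u} m k i]) ∧
      -- the recursive bound, which is itself below `ω ^ ω`
      OrdinalRamsey.Rcl.{u} (ω * m + 1) (k + 1) ≤
        ω ^ k + 1 +
          OrdinalRamsey.stepSeq.{u} m k (OrdinalRamsey.digraphRamsey m (k + 1) - 1) ∧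
      ω ^ k + 1 + OrdinalRamsey.stepSeq.{u} m k (OrdinalRamsey.digraphRamsey m (k + 1) - 1) <
        (ω : Ordinal.{u}) ^ (ω : Ordinal.{u})) ∧
    -- the special case `k = m = 2`
    OrdinalRamsey.Rcl.{u} (ω * 2 + 1) 3 ≤ ω ^ 8 * 7 + 1 := by
  refine ⟨fun k m hk hm => ?_, OrdinalRamsey.Rcl_omega_mul_two_add_one_three_le⟩
  obtain ⟨k, rfl⟩ := Nat.exists_eq_add_of_lt hk
  rw [zero_add]
  obtain ⟨h1, h2⟩ := OrdinalRamsey.exists_pairArrow.{u} hm k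
  obtain ⟨h3, h4⟩ := OrdinalRamsey.exists_pairArrow.{u} hm (k + 1)
  obtain ⟨h5, h6⟩ := OrdinalRamsey.Rtop_spec.{u} (k := k + 1) hm
  obtain ⟨h7, h8⟩ := OrdinalRamsey.stepSeq_spec h2
  exact ⟨h5, OrdinalRamsey.closedArrow_of_pairArrow h3, h6, h4,
    OrdinalRamsey.digraphRamsey_spec m _, OrdinalRamsey.closedArrow_of_pairArrow h1, h8,
    (OrdinalRamsey.closedArrow_Rcl (OrdinalRamsey.closedArrow_of_pairArrow
      (OrdinalRamsey.pairArrow_digraphRamsey hm h1 h2))).2,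
    OrdinalRamsey.add_lt_opow_omega0 (OrdinalRamsey.pow_add_one_lt _) (h7 _)⟩
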